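/- **Setting.** Fix integers $q,n\ge 0$, $H\ge 1$ and reals $p_{\max},d_{\max},\sigma>0$. A seller prices $q$ products over episodes of $H$ periods. The unknown parameter $\theta\in\mathbb R^l$ has a prior distribution with support $\Theta$. At the start of episode $k$ a covariate vector $z_k\in\mathcal Z\subseteq\mathbb R^m$ is observed, whose law given the past observations does not depend on $\theta$. At period $h$ the seller sets a price vector $P_{k,h}\in[0,p_{\max}]^q$; the state $S_{k,h}=(P_{k,\max(1,h-n)},\dots,P_{k,h-1})$ is the list of the (at most $n$) previous price vectors of the episode. The expected demand vector is $D_{k,h}=f_\theta(P_{k,h},S_{k,h},z_k)$ with a measurable $f$ such that, for $\theta\in\Theta$, all expected demands lie in $[0,d_{\max}]^q$. Given $\theta$, the covariates, the prices and the past, the realized demands $Y_{k,h}[j]$, $h\le H$, $j\le q$, are independent, $Y_{k,h}[j]$ being log-normal with parameters $D_{k,h}[j]-\sigma^2/2$ and $\sigma^2$. A policy $\mathbf P=(P_1,\dots,P_H)$ has in episode $k$ the value $V^k_{\mathbf P}=\sum_{h=1}^H P_h^\top f_\theta(P_h,S_h,z_k)$, where $S_h$ is the state that $\mathbf P$ induces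 at period $h$. It is assumed that maximizing policies exist for all $\theta\in\Theta$, $z\in\mathcal Z$ and that one is selected measurably; $\mathbf P^*_k$ is the maximizer for $\theta$ and $z_k$. *Thompson Pricing* (TP) draws at the start of episode $k$ a sample $\hat\theta_k$ from the posterior distribution of $\theta$ given the covariates, prices and demands of the previous episodes, independently of $\theta$ and $z_k$ given these, and applies the maximizer $\mathbf P_k$ for $\hat\theta_k$ and $z_k$. Its Bayesian regret is $R_K(TP)=\mathbb E\big[\sum_{k=1}^K(V^k_{\mathbf P^*_k}-V^k_{\mathbf P_k})\big]$. Let $\mathcal F=\{f_\theta:\theta\in\Theta\}$, as functions on $\mathcal X=[0,p_{\max}]^q\times\mathcal S\times\mathcal Z$, where $\mathcal S=\bigcup_{i=0}^n([0,p_{\max}]^q)^i$. Let $N(\mathcal F,\alpha)$ be the $\alpha$-covering number of $\mathcal F$ in the supremum norm (centres in $\mathcal F$) and $d_K(\mathcal F)=\limsup_{\alpha\downarrow0}\log N(\mathcal F,\alpha)/\log(1/\alpha)$ the Kolmogorov dimension. A point $x\in\mathcal X$ is $\epsilon$-dependent on $x_1,\dots,x_l$ if all $g_1,g_2\in\mathcal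 F$ with $\big(\sum_j\|g_1(x_j)-g_2(x_j)\|_2^2\big)^{1/2}\le\epsilon$ satisfy $\|g_1(x)-g_2(x)\|_2\le\epsilon$, and $\epsilon$-independent otherwise; the eluder dimension $d_E(\mathcal F,\epsilon)$ is the length of the longest sequence in $\mathcal X$ such that, for some $\epsilon'\ge\epsilon$, each element is $\epsilon'$-independent of its predecessors. **Theorem.** For every $K\ge1$, $$R_K(TP)\le q\,p_{\max}\Big(1+H d_{\max}\,d_E(\mathcal F,(KH)^{-2})+4\sqrt{\beta_K\,d_E(\mathcal F,(KH)^{-2})\,KH}\Big)+\frac{4q\,p_{\max}d_{\max}}{KH},$$ $$\beta_K=8\sigma^2\log\big((KH)^2N(\mathcal F,(KH)^{-2})\big)+\frac{2}{KH}\Big(8d_{\max}+\sqrt{8\sigma^2\log4}\Big)$$ (the bound being void if $d_E$ or $N$ is infinite). Asymptotically, as $K\to\infty$ in a fixed environment with $d_K(\mathcal F)>0$, $$R_K(TP)=O\Big(q\,p_{\max}\,\sigma\sqrt{d_K(\mathcal F)\,d_E(\mathcal F,(KH)^{-2})\,KH\log(KH)}\Big);$$ more precisely, for each $\kappa>0$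 there is a constant $C$ depending only on $\kappa$ such that in every such environment with $\kappa\le d_K(\mathcal F)<\infty$ the left side is at most $C$ times the expression in $O(\cdot)$ for all sufficiently large $K$. -/

import Mathlib

open MeasureTheory ProbabilityTheory Filter Topology
open scoped NNReal ENNReal

/-! ### Complexity measures of a class of functions -/

/-- With respect to the class `G` of functions `X → E`, the point `x` is `ε`-dependent on the
finite sequence `y`: any two members of `G` that are `ε`-close (in `ℓ²`) along `y` are `ε`-close
at `x`. -/
def EpsDependent {X E : Type*} [NormedAddCommGroup E] (G : Set (X → E)) (ε : ℝ) (x : X)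
    {l : ℕ} (y : Fin l → X) : Prop :=
  ∀ g₁ ∈ G, ∀ g₂ ∈ G,
    Real.sqrt (∑ j, ‖g₁ (y j) - g₂ (y j)‖ ^ 2) ≤ ε → ‖g₁ x - g₂ x‖ ≤ ε

/-- The `ε`-eluder dimension of `G`: the length of the longest sequence of points such that, for
some `ε' ≥ ε`, every point is `ε'`-independent of its predecessors (`⊤` if there are arbitrarily
long ones). -/
noncomputable def eluderDimension {X E : Type*} [NormedAddCommGroup E] (G : Set (X → E))
    (ε : ℝ) : ℕ∞ :=
  sSup {L : ℕ∞ | ∃ l : ℕ, L = l ∧ ∃ ε' : ℝ, ε ≤ ε' ∧ ∃ x : Fin l → X,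
    ∀ i : Fin l, ¬ EpsDependent G ε' (x i) (fun j : Fin (i : ℕ) => x (j.castLE i.isLt.le))}

/-- The `α`-covering number of `G` in the supremum norm (closed balls, centres in `G`). -/
noncomputable def supCoveringNumber {X E : Type*} [NormedAddCommGroup E] (G : Set (X → E))
    (α : ℝ) : ℕ∞ :=
  Metric.coveringNumber α.toNNReal (UniformFun.ofFun '' G)

/-- The Kolmogorov dimension `limsup_{α ↓ 0} log N(G, α) / log (1 / α)`. -/
noncomputable def kolmogorovDimension {X E : Type*} [NormedAddCommGroup E]
    (G : Set (X → E)) : EReal :=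
  limsup (fun α : ℝ =>
    ENNReal.log (supCoveringNumber G α : ℝ≥0∞) / ((Real.log (1 / α) : ℝ) : EReal)) (𝓝[>] 0)

/-! ### The pricing environment -/

/-- A vector indexed by the `q` products (prices, expected demands, realized demands). -/
abbrev ProductVec (q : ℕ) := Fin q → ℝ

/-- The unknown parameter `θ`. -/
abbrev Param (l : ℕ) := EuclideanSpace ℝ (Fin l)

/-- A vector of covariates. -/
abbrev Covariate (m : ℕ) := EuclideanSpace ℝ (Fin m)

/-- A state: a price history of some length `i ≤ n`. -/
abbrev PriceState (q n : ℕ) := Σ i : Fin (n + 1), (Fin (i : ℕ) → ProductVec q)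

/-- A pricing policy for one episode: a price vector for each of the `H` periods. -/
abbrev Policy (q H : ℕ) := Fin H → ProductVec q

/-- What the seller observes in one episode: the covariates, the prices that were set (these
determine the states), and the realized demands. -/
abbrev Episode (q H m : ℕ) := Covariate m × Policy q H × (Fin H → ProductVec q)

/-- The price vectors with all entries in `[0, p]`. -/
def priceBox (q : ℕ) (p : ℝ) : Set (ProductVec q) := {P | ∀ j, P j ∈ Set.Icc 0 p}

/-- The states in which all past prices lie in `[0, p]`. -/
def stateBox (q n : ℕ) (p : ℝ) : Set (PriceState q n) := {S | ∀ i, S.2 i ∈ priceBox q p}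

/-- The policies with all prices in `[0, p]`. -/
def policyBox (q H : ℕ) (p : ℝ) : Set (Policy q H) := {P | ∀ h, P h ∈ priceBox q p}

/-- The state at period `h` under the policy `P`: the last `min n h` price vectors before `h`,
oldest first (periods are numbered `0, …, H - 1`). -/
def stateAt {q H : ℕ} (n : ℕ) (P : Policy q H) (h : Fin H) : PriceState q n :=
  ⟨⟨min n h, Nat.lt_succ_of_le (min_le_left _ _)⟩,
    fun j => P ⟨(h : ℕ) - min n h + j, by
      have hj : (j : ℕ) < min n h := j.isLt
      have hh := h.isLt
      have := min_le_right n (h : ℕ)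
      omega⟩⟩

/-- The expected revenue `∑ₕ Pₕᵀ f(Pₕ, Sₕ)` of a policy in one episode, for the expected demand
function `f`. -/
def revenue {q n H : ℕ} (f : ProductVec q → PriceState q n → ProductVec q) (P : Policy q H) : ℝ :=
  ∑ h, ∑ j, P h j * f (P h) (stateAt n P h) j

/-- An instance of the pricing problem with `q` products, memory `n`, `H` periods per episode,
parameter in `ℝˡ` and covariates in `ℝᵐ`, together with the planning routine used by the seller. -/
structure PricingModel (q n H l m : ℕ) where
  /-- the maximal price -/
  pMax : ℝ
  pMax_pos : 0 < pMax
  /-- the bound on expected demands -/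
  dMax : ℝ
  dMax_pos : 0 < dMax
  /-- the demand uncertainty -/
  σ : ℝ
  σ_pos : 0 < σ
  /-- the prior distribution of the unknown parameter -/
  prior : Measure (Param l)
  prior_prob : IsProbabilityMeasure prior
  /-- the set of all possible covariate vectors -/
  covariates : Set (Covariate m)
  /-- the expected demand vector `f_θ(P, S, z)` -/
  demand : Param l → ProductVec q → PriceState q n → Covariate m → ProductVec q
  measurable_demand : Measurable fun u : Param l × ProductVec q × PriceState q n × Covariate m =>
    demand u.1 u.2.1 u.2.2.1 u.2.2.2
  demand_mem : ∀ θ ∈ prior.support, ∀ P ∈ priceBox q pMax, ∀ S ∈ stateBox q n pMax,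
    ∀ z ∈ covariates, ∀ j, demand θ P S z j ∈ Set.Icc 0 dMax
  /-- the conditional law of the covariates of the next episode, given the `k` past episodes -/
  covariateLaw : (k : ℕ) → Kernel (Fin k → Episode q H m) (Covariate m)
  covariateLaw_prob : ∀ k, IsMarkovKernel (covariateLaw k)
  covariateLaw_mem : ∀ k hist, ∀ᵐ z ∂(covariateLaw k hist), z ∈ covariates
  /-- the planning routine `DP(θ, z)`: a policy of maximal expected revenue for `θ` and `z` -/
  plan : Param l → Covariate m → Policy q H
  measurable_plan : Measurable fun u : Param l × Covariate m => plan u.1 u.2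
  plan_mem : ∀ θ ∈ prior.support, ∀ z ∈ covariates, plan θ z ∈ policyBox q H pMax
  plan_isMaxOn : ∀ θ ∈ prior.support, ∀ z ∈ covariates,
    IsMaxOn (revenue fun P S => demand θ P S z) (policyBox q H pMax) (plan θ z)

namespace PricingModel

variable {q n H l m : ℕ} (M : PricingModel q n H l m)

instance : IsProbabilityMeasure M.prior := M.prior_prob

instance (k : ℕ) : IsMarkovKernel (M.covariateLaw k) := M.covariateLaw_prob k

/-- The set on which the demand functions are considered: prices, states, and covariates. -/
def domain : Set (ProductVec q × PriceState q n × Covariate m) :=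
  priceBox q M.pMax ×ˢ stateBox q n M.pMax ×ˢ M.covariates

/-- The class `𝓕` of demand functions spanned by the support of the prior. -/
def demandClass : Set (M.domain → ProductVec q) :=
  (fun θ (u : M.domain) => M.demand θ u.1.1 u.1.2.1 u.1.2.2) '' M.prior.support

/-- The covering number `N(𝓕, α)` in the supremum norm (over points and products). -/
noncomputable def coveringNumber (α : ℝ) : ℕ∞ := supCoveringNumber M.demandClass α

/-- The Kolmogorov dimension of `𝓕`. -/
noncomputable def kolmogorovDim : EReal := kolmogorovDimension M.demandClass

/-- The eluder dimension of `𝓕`, demand vectors being compared in the Euclidean norm. -/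
noncomputable def eluderDim (ε : ℝ) : ℕ∞ :=
  eluderDimension ((fun g u => WithLp.toLp 2 (g u)) '' M.demandClass :
    Set (M.domain → EuclideanSpace ℝ (Fin q))) ε

/-- The value of the policy `P` under the parameter `θ` and the covariates `z`. -/
def value (θ : Param l) (z : Covariate m) (P : Policy q H) : ℝ :=
  revenue (fun P' S => M.demand θ P' S z) P

/-- The demands realized in an episode. If `ξ` consists of independent standard normal variables,
the entries are independent, log-normal with parameters `D - σ² / 2` and `σ²`, where `D` is the
expected demand. -/
noncomputable def realizedDemand (θ : Param l) (z : Covariate m) (P : Policy q H)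
    (ξ : Fin H → ProductVec q) : Fin H → ProductVec q :=
  fun h j => Real.exp (M.demand θ (P h) (stateAt n P h) z j - M.σ ^ 2 / 2 + M.σ * ξ h j)

/-- The law of the standard normal noise of one episode. -/
noncomputable def noiseLaw (q H : ℕ) : Measure (Fin H → ProductVec q) :=
  Measure.pi fun _ => Measure.pi fun _ => gaussianReal 0 1

instance (q H : ℕ) : IsProbabilityMeasure (noiseLaw q H) := by
  unfold noiseLaw; infer_instance

/-- The outcomes of the first `k` episodes: the true parameter and, for each episode, the parameter
sampled by the seller and the observations. -/
abbrev Outcome (q H l m k : ℕ) := Param l × (Fin k → Param l × Episode q H m)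

/-- The history of observations. It contains neither the true nor the sampled parameters. -/
def observed {q H l m k : ℕ} (ω : Outcome q H l m k) : Fin k → Episode q H m :=
  fun i => (ω.2 i).2

/-- The outcome after one more episode with covariates `z`, in which the seller samples `θ'`, plans
with `θ'`, and the demand noise is `ξ`. -/
noncomputable def extend (k : ℕ)
    (u : (Outcome q H l m k × Covariate m × Param l) × (Fin H → ProductVec q)) :
    Outcome q H l m (k + 1) :=
  (u.1.1.1, Fin.snoc u.1.1.2 (u.1.2.2, u.1.2.1, M.plan u.1.2.2 u.1.2.1,
    M.realizedDemand u.1.1.1 u.1.2.1 (M.plan u.1.2.2 u.1.2.1) u.2))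

theorem measurable_observed {k : ℕ} :
    Measurable (observed : Outcome q H l m k → (Fin k → Episode q H m)) := by
  unfold observed
  fun_prop

theorem measurable_stateAt (h : Fin H) :
    Measurable fun P : Policy q H => (stateAt n P h : PriceState q n) := by
  have hmk : Measurable (Sigma.mk (β := fun i : Fin (n + 1) => (Fin (i : ℕ) → ProductVec q))
      ⟨min n h, Nat.lt_succ_of_le (min_le_left _ _)⟩) :=
    Measurable.of_le_map (iInf_le _ _)
  unfold stateAt
  refine hmk.comp ?_
  fun_prop

theorem measurable_realizedDemand :
    Measurable fun u : Param l × Covariate m × Policy q H × (Fin H → ProductVec q) =>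
      M.realizedDemand u.1 u.2.1 u.2.2.1 u.2.2.2 := by
  unfold realizedDemand
  refine measurable_pi_iff.2 fun h => measurable_pi_iff.2 fun j => ?_
  have hD : Measurable fun u : Param l × Covariate m × Policy q H × (Fin H → ProductVec q) =>
      M.demand u.1 (u.2.2.1 h) (stateAt n u.2.2.1 h) u.2.1 := by
    have hS : Measurable fun u : Param l × Covariate m × Policy q H × (Fin H → ProductVec q) =>
        (stateAt n u.2.2.1 h : PriceState q n) := (measurable_stateAt h).comp (by fun_prop)
    have hg : Measurable fun u : Param l × Covariate m × Policy q H × (Fin H → ProductVec q) =>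
        (u.1, u.2.2.1 h, (stateAt n u.2.2.1 h : PriceState q n), u.2.1) :=
      measurable_fst.prodMk ((by fun_prop : Measurable fun u : Param l × Covariate m ×
        Policy q H × (Fin H → ProductVec q) => u.2.2.1 h).prodMk (hS.prodMk (by fun_prop)))
    exact M.measurable_demand.comp hg
  have hDj := (measurable_pi_apply j).comp hD
  exact ((hDj.sub_const _).add (by fun_prop)).exp

theorem measurable_extend (k : ℕ) : Measurable (M.extend k) := by
  unfold extend
  have hplan : Measurable fun u : (Outcome q H l m k × Covariate m × Param l) ×
      (Fin H → ProductVec q) => M.plan u.1.2.2 u.1.2.1 :=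
    M.measurable_plan.comp (by fun_prop :
      Measurable fun u : (Outcome q H l m k × Covariate m × Param l) ×
        (Fin H → ProductVec q) => (u.1.2.2, u.1.2.1))
  have hY : Measurable fun u : (Outcome q H l m k × Covariate m × Param l) ×
      (Fin H → ProductVec q) =>
      M.realizedDemand u.1.1.1 u.1.2.1 (M.plan u.1.2.2 u.1.2.1) u.2 :=
    M.measurable_realizedDemand.comp ((by fun_prop : Measurable fun u : (Outcome q H l m k ×
      Covariate m × Param l) × (Fin H → ProductVec q) => u.1.1.1).prodMk
        ((by fun_prop : Measurable fun u : (Outcome q H l m k × Covariate m × Param l) ×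
          (Fin H → ProductVec q) => u.1.2.1).prodMk (hplan.prodMk measurable_snd)))
  refine (by fun_prop : Measurable fun u : (Outcome q H l m k × Covariate m × Param l) ×
    (Fin H → ProductVec q) => u.1.1.1).prodMk (measurable_pi_iff.2 fun i => ?_)
  refine Fin.lastCases ?_ (fun i => ?_) i
  · simp only [Fin.snoc_last]
    exact (by fun_prop : Measurable fun u : (Outcome q H l m k × Covariate m × Param l) ×
      (Fin H → ProductVec q) => u.1.2.2).prodMk
        ((by fun_prop : Measurable fun u : (Outcome q H l m k × Covariate m × Param l) ×
          (Fin H → ProductVec q) => u.1.2.1).prodMk (hplan.prodMk hY))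
  · simp only [Fin.snoc_castSucc]
    fun_prop

/-- The posterior distribution of the true parameter, given the history of observations, when `μ`
is the joint law of the outcomes of the first `k` episodes. -/
noncomputable def posterior {k : ℕ} (μ : Measure (Outcome q H l m k)) [IsFiniteMeasure μ] :
    Kernel (Fin k → Episode q H m) (Param l) :=
  condDistrib Prod.fst observed μ

instance {k : ℕ} (μ : Measure (Outcome q H l m k)) [IsFiniteMeasure μ] :
    IsMarkovKernel (posterior μ) := by
  unfold posterior; infer_instance

/-- Given the observed history (and independently of everything else), draw the covariates of the
next episode from their law and the seller's sample from the posterior. -/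
noncomputable def draw {k : ℕ} (μ : Measure (Outcome q H l m k)) [IsFiniteMeasure μ] :
    Kernel (Outcome q H l m k) (Covariate m × Param l) :=
  (M.covariateLaw k ×ₖ posterior μ).comap observed measurable_observed

instance {k : ℕ} (μ : Measure (Outcome q H l m k)) [IsFiniteMeasure μ] :
    IsMarkovKernel (M.draw μ) := by
  unfold draw; infer_instance

/-- The joint law of the outcomes of the first `k` episodes when the seller uses Thompson
Pricing. -/
noncomputable def outcomeLaw :
    (k : ℕ) → {μ : Measure (Outcome q H l m k) // IsProbabilityMeasure μ}
  | 0 => ⟨M.prior.map fun θ => (θ, Fin.elim0),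
      Measure.isProbabilityMeasure_map (by fun_prop)⟩
  | k + 1 =>
    haveI := (outcomeLaw k).2
    ⟨(((outcomeLaw k).1 ⊗ₘ M.draw (outcomeLaw k).1).prod (noiseLaw q H)).map (M.extend k),
      Measure.isProbabilityMeasure_map (M.measurable_extend k).aemeasurable⟩

/-- The Bayesian regret of Thompson Pricing over `K` episodes: the expectation of
`∑ₖ (V^k(P*_k) - V^k(P_k))`, where `P*_k` is optimal for the true parameter and `P_k` is the policy
applied in episode `k`. -/
noncomputable def regret (K : ℕ) : ℝ :=
  ∫ ω, ∑ k : Fin K,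
    (M.value ω.1 (ω.2 k).2.1 (M.plan ω.1 (ω.2 k).2.1)
      - M.value ω.1 (ω.2 k).2.1 (ω.2 k).2.2.1) ∂(M.outcomeLaw K).1

/-- The quantity `β_K`, as a function of `T = K H` and of the covering number `N`. -/
noncomputable def beta (T N : ℝ) : ℝ :=
  8 * M.σ ^ 2 * Real.log (T ^ 2 * N)
    + 2 / T * (8 * M.dMax + Real.sqrt (8 * M.σ ^ 2 * Real.log 4))

end PricingModel

/-!
Let `T = K H` and `α = T⁻²`.

**Reduction to estimation.** Given the observed history, the true parameter `θ` and the sampled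
parameter `θ'` are exchangeable, and both are independent of the next covariates. Hence the optimal
value has the same expectation under both, and the regret is the expected sum of the differences
between the values that `θ'` and `θ` assign to the policy planned for `θ'`. These are controlled by
the distances of the expected demands at the prices that are actually set
(`integral_value_plan_eq`, `value_sub_value_le`).

**Confidence.** The logarithm of a realized demand is the expected demand plus Gaussian noise of
variance `σ²`. For each parameter `θ₀` from a finite `α`-cover, the compensated square root of the
likelihood ratio of `θ₀` against the true parameter has expectation one, so with high probability
all these ratios are below `T² N`, and the `ℓ¹` norm of the noise is of order `q T σ`
(`law_misleading_le`). Of two candidate parameters one fits the history at least as well as the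
other. By exchangeability it does not matter which, and replacing the better one by its
neighbour in the cover shows that the squared distance of the expected demands along the history is
at most `4 q β` (`sum_sq_expectedDemand_sub_le`).

**Eluder dimension.** If the demands under `θ` and `θ'` differ by more than `ε` at a point while
their squared distance over the earlier episodes is at most `Γ`, then the point is `ε`-independent
of one of any `⌊Γ / ε²⌋ + H` disjoint sets of previous such points, since at most `H - 1` of these
meet the current episode. Distributing the points greedily over that many `ε`-independent sequences
bounds their number by `(Γ / ε² + H) d_E` (`card_le_of_large_deviation`), and summing over the
levels `ε` gives the bound (`sum_le_of_card_filter_le`).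

The factor `q` of the theorem is used as `√q · √q`: one factor compares the `ℓ¹` and `ℓ²` norms of
demand vectors, the other comes from covering in the supremum norm and from the number of
observations.

**Asymptotics.** Positivity of the Kolmogorov dimension forces `d_E ≥ 1` at small scales. For
`d_E ≤ T` all terms of the finite-time bound other than the leading one are of lower order; for
`d_E > T` the trivial bound on the regret suffices.
-/

/-! ### Eluder dimension: counting large deviations -/

section Eluder

variable {X E ι : Type*} [NormedAddCommGroup E] [LinearOrder ι]

/-- `ε`-dependence, with respect to `G`, of the point `x t` on the points `x s`, `s ∈ B`. -/
def EpsDependentOn (G : Set (X → E)) (ε : ℝ) (x : ι → X) (t : ι) (B : Finset ι) : Prop :=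
  ∀ g₁ ∈ G, ∀ g₂ ∈ G,
    Real.sqrt (∑ s ∈ B, ‖g₁ (x s) - g₂ (x s)‖ ^ 2) ≤ ε → ‖g₁ (x t) - g₂ (x t)‖ ≤ ε

/-- Greedy colouring: if no point depends on all `L` colour classes of its predecessors at once,
then the points can be coloured so that each is independent of the earlier points of its colour. -/
theorem exists_coloring_of_not_epsDependentOn (G : Set (X → E)) (ε : ℝ) (x : ι → X) {L : ℕ}
    (hL : 0 < L) (S : Finset ι)
    (h : ∀ t ∈ S, ∀ c : ι → Fin L,
      ∃ b, ¬ EpsDependentOn G ε x t (S.filter fun s => s < t ∧ c s = b)) :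
    ∃ c : ι → Fin L, ∀ t ∈ S,
      ¬ EpsDependentOn G ε x t (S.filter fun s => s < t ∧ c s = c t) := by
  classical
  induction S using Finset.induction_on_max with
  | empty => exact ⟨fun _ => ⟨0, hL⟩, by simp⟩
  | insert a S ha ih =>
    have key : ∀ t ∈ S, ∀ c : ι → Fin L, ∀ b : Fin L,
        ((insert a S).filter fun s => s < t ∧ c s = b) = S.filter fun s => s < t ∧ c s = b := by
      intro t ht c b
      rw [Finset.filter_insert, if_neg]
      exact fun h' => (lt_asymm h'.1 (ha t ht)).elim
    obtain ⟨c, hc⟩ := ih fun t ht c => by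
      obtain ⟨b, hb⟩ := h t (Finset.mem_insert_of_mem ht) c
      exact ⟨b, by rwa [key t ht c b] at hb⟩
    obtain ⟨b, hb⟩ := h a (Finset.mem_insert_self a S) c
    refine ⟨Function.update c a b, fun t ht => ?_⟩
    have hupd : ∀ s, s < t → t ∈ insert a S → Function.update c a b s = c s := by
      intro s hs ht'
      refine Function.update_of_ne ?_ _ _
      rintro rfl
      rcases Finset.mem_insert.1 ht' with rfl | h'
      · exact lt_irrefl _ hs
      · exact lt_asymm hs (ha t h')
    have hcongr : ∀ b', ((insert a S).filter fun s => s < t ∧ Function.update c a b s = b')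
        = (insert a S).filter fun s => s < t ∧ c s = b' := by
      intro b'
      refine Finset.filter_congr fun s _ => and_congr_right fun hs => ?_
      rw [hupd s hs ht]
    rw [hcongr]
    rcases Finset.mem_insert.1 ht with rfl | ht'
    · simpa using hb
    · have hne : t ≠ a := (ha t ht').ne
      rw [Function.update_of_ne hne, key t ht']
      exact hc t ht'

/-- A finite family in which every point is `ε`-independent of its predecessors has at most as many
members as the eluder dimension. -/
theorem card_le_eluderDimension (G : Set (X → E)) {α ε : ℝ} (hαε : α ≤ ε) (x : ι → X)
    (B : Finset ι) (h : ∀ t ∈ B, ¬ EpsDependentOn G ε x t (B.filter fun s => s < t)) :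
    (B.card : ℕ∞) ≤ eluderDimension G α := by
  classical
  refine le_sSup ⟨B.card, rfl, ε, hαε, fun i => x (B.orderEmbOfFin rfl i), fun i hdep => ?_⟩
  refine h _ (B.orderEmbOfFin_mem rfl i) fun g₁ h₁ g₂ h₂ hs => ?_
  refine hdep g₁ h₁ g₂ h₂ (le_of_eq_of_le ?_ hs)
  congr 1
  refine Finset.sum_bij (fun j _ => B.orderEmbOfFin rfl (j.castLE i.isLt.le)) ?_ ?_ ?_ ?_
  · intro j _
    refine Finset.mem_filter.2 ⟨B.orderEmbOfFin_mem rfl _, ?_⟩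
    exact (B.orderEmbOfFin rfl).lt_iff_lt.2 (Fin.lt_def.2 j.isLt)
  · intro j _ j' _ hjj
    have := (B.orderEmbOfFin rfl).injective hjj
    exact Fin.ext (by simpa [Fin.ext_iff] using this)
  · intro s hs
    obtain ⟨hsB, hst⟩ := Finset.mem_filter.1 hs
    have : s ∈ Set.range (B.orderEmbOfFin rfl) := by
      rw [Finset.range_orderEmbOfFin]; exact hsB
    obtain ⟨j, rfl⟩ := this
    exact ⟨⟨j, (B.orderEmbOfFin rfl).lt_iff_lt.1 hst⟩, Finset.mem_univ _, rfl⟩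
  · intro j _
    rfl

/-- The key counting lemma for the eluder dimension `d`. Points are grouped into batches of at most
`H`. If at each point of `S` some pair of members of `G` differs by more than `ε`, although their
squared distance summed over the earlier batches is at most `Γ`, then
`|S| ≤ (Γ / ε² + H) d`. -/
theorem card_le_of_large_deviation (G : Set (X → E)) {α ε Γ : ℝ} {d H : ℕ} (hαε : α ≤ ε)
    (hε : 0 < ε) (hΓ : 0 ≤ Γ) (hH : 1 ≤ H) (hd : eluderDimension G α = d) (x : ι → X)
    (batch : ι → ℕ) (hbatch : Monotone batch) (S : Finset ι)
    (hfib : ∀ k, (S.filter fun s => batch s = k).card ≤ H)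
    (u v : ι → X → E) (hu : ∀ t ∈ S, u t ∈ G) (hv : ∀ t ∈ S, v t ∈ G)
    (hlarge : ∀ t ∈ S, ε < ‖u t (x t) - v t (x t)‖)
    (hpast : ∀ t ∈ S,
      ∑ s ∈ S.filter (fun s => batch s < batch t), ‖u t (x s) - v t (x s)‖ ^ 2 ≤ Γ) :
    (S.card : ℝ) ≤ (Γ / ε ^ 2 + H) * d := by
  classical
  set M := ⌊Γ / ε ^ 2⌋₊ with hM
  have hL : 0 < M + H := by omega
  obtain ⟨c, hc⟩ := exists_coloring_of_not_epsDependentOn G ε x hL S fun t ht c => by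
    by_contra! hcon
    -- `t` depends on all `M + H` classes; at most `H - 1` of them meet the batch of `t`
    set same := (S.filter fun s => s < t ∧ batch s = batch t).image c with hsame
    have hcard_same : same.card < H := by
      refine Finset.card_image_le.trans_lt ?_
      refine lt_of_lt_of_le (Finset.card_lt_card ?_) (hfib (batch t))
      refine Finset.ssubset_iff_of_subset (fun s hs => ?_) |>.2 ⟨t, ?_, ?_⟩
      · simp only [Finset.mem_filter] at hs ⊢; exact ⟨hs.1, hs.2.2⟩
      · simp [ht]
      · simp
    have hbig : ∀ b, ε ^ 2 <
        ∑ s ∈ S.filter (fun s => s < t ∧ c s = b), ‖u t (x s) - v t (x s)‖ ^ 2 := by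
      intro b
      by_contra! hle
      exact absurd (hcon b _ (hu t ht) _ (hv t ht) ((Real.sqrt_le_iff).2 ⟨hε.le, hle⟩))
        (not_le.2 (hlarge t ht))
    have hsum : ((sameᶜ).card : ℝ) * ε ^ 2 ≤ Γ := by
      calc ((sameᶜ).card : ℝ) * ε ^ 2
          = ∑ _b ∈ sameᶜ, ε ^ 2 := by simp
        _ ≤ ∑ b ∈ sameᶜ, ∑ s ∈ S.filter (fun s => s < t ∧ c s = b),
              ‖u t (x s) - v t (x s)‖ ^ 2 := Finset.sum_le_sum fun b _ => (hbig b).le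
        _ ≤ ∑ b ∈ sameᶜ, ∑ s ∈ (S.filter (fun s => batch s < batch t)).filter (fun s => c s = b),
              ‖u t (x s) - v t (x s)‖ ^ 2 := by
            refine Finset.sum_le_sum fun b hb => Finset.sum_le_sum_of_subset_of_nonneg ?_
              fun _ _ _ => by positivity
            intro s hs
            simp only [Finset.mem_filter] at hs ⊢
            refine ⟨⟨hs.1, lt_of_le_of_ne (hbatch hs.2.1.le) fun heq => ?_⟩, hs.2.2⟩
            refine Finset.mem_compl.1 hb (Finset.mem_image.2 ⟨s, ?_, hs.2.2⟩)
            exact Finset.mem_filter.2 ⟨hs.1, hs.2.1, heq⟩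
        _ ≤ ∑ b, ∑ s ∈ (S.filter (fun s => batch s < batch t)).filter (fun s => c s = b),
              ‖u t (x s) - v t (x s)‖ ^ 2 :=
            Finset.sum_le_sum_of_subset_of_nonneg (Finset.subset_univ _)
              fun _ _ _ => Finset.sum_nonneg fun _ _ => by positivity
        _ = ∑ s ∈ S.filter (fun s => batch s < batch t), ‖u t (x s) - v t (x s)‖ ^ 2 :=
            Finset.sum_fiberwise _ _ _
        _ ≤ Γ := hpast t ht
    have hcompl : M + 1 ≤ (sameᶜ).card := by
      rw [Finset.card_compl, Fintype.card_fin]; omega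
    have hlt : Γ / ε ^ 2 < M + 1 := Nat.lt_floor_add_one _
    have h1 : (M : ℝ) + 1 ≤ (sameᶜ).card := by exact_mod_cast hcompl
    have h2 : ((sameᶜ).card : ℝ) ≤ Γ / ε ^ 2 := by rwa [le_div_iff₀ (by positivity)]
    linarith
  have hcls : ∀ b : Fin (M + H), (S.filter fun s => c s = b).card ≤ d := by
    intro b
    have := card_le_eluderDimension G hαε x (S.filter fun s => c s = b) fun t ht => by
      obtain ⟨htS, htb⟩ := Finset.mem_filter.1 ht
      have h := hc t htS
      rw [htb] at h
      rw [Finset.filter_filter]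
      simpa only [and_comm] using h
    rw [hd] at this
    exact_mod_cast this
  have hcard : S.card ≤ (M + H) * d := by
    rw [Finset.card_eq_sum_card_fiberwise (f := c) (t := Finset.univ) (by simp)]
    exact (Finset.sum_le_card_nsmul _ _ _ fun b _ => hcls b).trans (by simp)
  calc (S.card : ℝ) ≤ ((M + H) * d : ℕ) := by exact_mod_cast hcard
    _ = ((M : ℝ) + H) * d := by push_cast; ring
    _ ≤ (Γ / ε ^ 2 + H) * d := by
        gcongr
        exact Nat.floor_le (by positivity)

end Eluder

/-! ### Real inequalities -/

/-- Summation of a tail bound: if all values are at most `C`, and for each `ε ≥ α` at most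
`A / ε² + B` of them exceed `ε`, then their sum is at most `n α + B C + 2 √(A n)`. -/
theorem sum_le_of_card_filter_le {ι : Type*} (S : Finset ι) (w : ι → ℝ) {α A C : ℝ} {B : ℕ}
    (hα : 0 < α) (hA : 0 ≤ A) (hC : 0 ≤ C) (hw : ∀ i ∈ S, w i ≤ C)
    (hcard : ∀ ε, α ≤ ε → ((S.filter fun i => ε < w i).card : ℝ) ≤ A / ε ^ 2 + B) :
    ∑ i ∈ S, w i ≤ S.card * α + B * C + 2 * Real.sqrt (A * S.card) := by
  classical
  -- the sharper bound proved by induction, removing a minimal element at each step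
  suffices H : ∀ m : ℕ, ∀ S : Finset ι, S.card = m → (∀ i ∈ S, w i ≤ C) →
      (∀ ε, α ≤ ε → ((S.filter fun i => ε < w i).card : ℝ) ≤ A / ε ^ 2 + B) →
      ∑ i ∈ S, w i ≤ m * α + (min m B : ℕ) * C + 2 * (√A * √((m - B : ℕ) : ℝ)) by
    refine (H _ S rfl hw hcard).trans ?_
    rw [Real.sqrt_mul hA]
    have h1 : ((min S.card B : ℕ) : ℝ) ≤ B := by exact_mod_cast min_le_right _ _
    have h2 : ((S.card - B : ℕ) : ℝ) ≤ S.card := by exact_mod_cast Nat.sub_le _ _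
    gcongr
  intro m
  induction m with
  | zero =>
    intro S hS _ _
    rw [Finset.card_eq_zero.1 hS]; simp
  | succ m ih =>
    intro S hS hw hcard
    have hne : S.Nonempty := Finset.card_pos.1 (by omega)
    obtain ⟨a, haS, hmin⟩ := S.exists_min_image w hne
    have hrec := ih (S.erase a) (by rw [Finset.card_erase_of_mem haS, hS]; rfl)
      (fun i hi => hw i (Finset.mem_of_mem_erase hi)) (fun ε hε => le_trans (by
        exact_mod_cast Finset.card_le_card (Finset.filter_subset_filter _ (S.erase_subset a)))
          (hcard ε hε))
    rw [← Finset.add_sum_erase S w haS]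
    rcases Nat.lt_or_ge m B with hmB | hmB
    · have e1 : m + 1 - B = m - B := by omega
      have e2 : min (m + 1) B = m + 1 := by omega
      have e3 : min m B = m := by omega
      rw [e3] at hrec
      rw [e1, e2]
      have := hw a haS
      push_cast
      nlinarith
    · obtain ⟨s, rfl⟩ := Nat.exists_eq_add_of_le hmB
      have e1 : B + s + 1 - B = s + 1 := by omega
      have e2 : min (B + s + 1) B = B := by omega
      have e3 : min (B + s) B = B := by omega
      have e4 : B + s - B = s := by omega
      rw [e3, e4] at hrec
      rw [e1, e2]
      have hs1 : (0 : ℝ) < √((s : ℝ) + 1) := Real.sqrt_pos.2 (by positivity)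
      have hs1sq : √((s : ℝ) + 1) ^ 2 = s + 1 := Real.sq_sqrt (by positivity)
      have hssq : √(s : ℝ) ^ 2 = s := Real.sq_sqrt (by positivity)
      -- all `B + s + 1` values are at least `w a`, so a larger `w a` would violate the tail bound
      have hwa : w a ≤ α + √A / √((s : ℝ) + 1) := by
        by_contra! hlt
        have hall : (S.filter fun i => α + √A / √((s : ℝ) + 1) < w i) = S :=
          Finset.filter_true_of_mem fun i hi => hlt.trans_le (hmin i hi)
        have hq : 0 ≤ √A / √((s : ℝ) + 1) := by positivity
        have h := hcard (α + √A / √((s : ℝ) + 1)) (by linarith)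
        rw [hall, hS] at h
        push_cast at h
        have h' : (s : ℝ) + 1 ≤ A / (α + √A / √((s : ℝ) + 1)) ^ 2 := by linarith
        rw [le_div_iff₀ (by positivity)] at h'
        have hsqA : √A ^ 2 = A := Real.sq_sqrt hA
        have : (√A / √((s : ℝ) + 1)) ^ 2 * (s + 1) = A := by
          rw [div_pow, hs1sq, hsqA]; field_simp
        nlinarith [mul_pos (mul_pos hα hα) (by positivity : (0 : ℝ) < s + 1),
          mul_nonneg (mul_nonneg hα.le hq) (by positivity : (0 : ℝ) ≤ (s : ℝ) + 1)]
      -- `1 / √(s + 1) ≤ 2 (√(s + 1) - √s)`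
      have hstep : 1 / √((s : ℝ) + 1) ≤ 2 * (√((s : ℝ) + 1) - √(s : ℝ)) := by
        rw [div_le_iff₀ hs1]
        nlinarith [sq_nonneg (√((s : ℝ) + 1) - √(s : ℝ))]
      have hA' : √A / √((s : ℝ) + 1) ≤ √A * (2 * (√((s : ℝ) + 1) - √(s : ℝ))) := by
        rw [div_eq_mul_one_div]
        exact mul_le_mul_of_nonneg_left hstep (Real.sqrt_nonneg _)
      push_cast at hrec ⊢
      nlinarith

/-- Least squares with a discretization. Here `y` are the data, `a` and `b` two candidate
regression functions of which `b` fits the data at least as well, and `c` is uniformly `α`-close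
to `b`. If the (tilted) log-likelihood ratio of `c` against `a` is at most `Λ` and the residuals
of `a` have `ℓ¹` norm at most `s`, then `a` and `b` are close in `ℓ²`. -/
theorem sum_sq_sub_le_of_sum_sq_residual_le {ι : Type*} (I : Finset ι) (y a b c : ι → ℝ)
    {σ α D Λ s : ℝ} (hσ : 0 < σ) (hα : 0 ≤ α)
    (ha : ∀ i ∈ I, a i ∈ Set.Icc 0 D) (hb : ∀ i ∈ I, b i ∈ Set.Icc 0 D)
    (hc : ∀ i ∈ I, c i ∈ Set.Icc 0 D) (hbc : ∀ i ∈ I, |b i - c i| ≤ α)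
    (hfit : ∑ i ∈ I, (y i - b i) ^ 2 ≤ ∑ i ∈ I, (y i - a i) ^ 2)
    (hΛ : ∑ i ∈ I, (((y i - a i) ^ 2 - (y i - c i) ^ 2) / (4 * σ ^ 2)
      + (c i - a i) ^ 2 / (8 * σ ^ 2)) ≤ Λ)
    (hs : ∑ i ∈ I, |y i - a i| ≤ s) :
    ∑ i ∈ I, (b i - a i) ^ 2 ≤ 16 * σ ^ 2 * Λ + 8 * α * s + 10 * α * D * I.card := by
  have h1 : ∑ i ∈ I, (y i - c i) ^ 2
      ≤ ∑ i ∈ I, ((y i - b i) ^ 2 + 2 * α * |y i - a i| + 2 * α * D) := by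
    refine Finset.sum_le_sum fun i hi => ?_
    have hA := ha i hi; have hB := hb i hi; have hC := hc i hi; have hBC := hbc i hi
    have e : (y i - c i) ^ 2 - (y i - b i) ^ 2
        = 2 * ((b i - c i) * (y i - a i)) + (b i - c i) * (2 * a i - b i - c i) := by ring
    have e1 : (b i - c i) * (y i - a i) ≤ α * |y i - a i| :=
      (le_abs_self _).trans (by rw [abs_mul]; gcongr)
    have e2 : (b i - c i) * (2 * a i - b i - c i) ≤ α * (2 * D) := by
      refine (le_abs_self _).trans ?_
      rw [abs_mul]
      gcongr
      rw [abs_le]; constructor <;> linarith [hA.1, hA.2, hB.1, hB.2, hC.1, hC.2]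
    linarith
  have h2 : ∑ i ∈ I, (b i - a i) ^ 2 ≤ ∑ i ∈ I, (2 * α * D + 2 * (c i - a i) ^ 2) := by
    refine Finset.sum_le_sum fun i hi => ?_
    have hB := hb i hi; have hC := hc i hi; have hBC := hbc i hi
    have e2 : (b i - c i) ^ 2 ≤ α * D := by
      rw [← sq_abs, sq]
      gcongr
      rw [abs_le]; constructor <;> linarith [hB.1, hB.2, hC.1, hC.2]
    nlinarith [sq_nonneg (b i - c i - (c i - a i))]
  have h3 : ∑ i ∈ I, (((y i - a i) ^ 2 - (y i - c i) ^ 2) / (4 * σ ^ 2)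
      + (c i - a i) ^ 2 / (8 * σ ^ 2)) = (2 * ∑ i ∈ I, (y i - a i) ^ 2
        - 2 * ∑ i ∈ I, (y i - c i) ^ 2 + ∑ i ∈ I, (c i - a i) ^ 2) / (8 * σ ^ 2) := by
    rw [Finset.mul_sum, Finset.mul_sum, ← Finset.sum_sub_distrib, ← Finset.sum_add_distrib,
      Finset.sum_div]
    refine Finset.sum_congr rfl fun i _ => ?_
    field_simp
    ring
  rw [h3, div_le_iff₀ (by positivity)] at hΛ
  simp only [Finset.sum_add_distrib, ← Finset.mul_sum, Finset.sum_const, nsmul_eq_mul] at h1 h2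
  have h4 : α * ∑ i ∈ I, |y i - a i| ≤ α * s := by gcongr
  nlinarith

/-! ### The law of the outcomes -/

namespace PricingModel

variable {q n H l m : ℕ} (M : PricingModel q n H l m)

/-- The joint law of the outcomes of the first `k` episodes. -/
noncomputable abbrev law (k : ℕ) : Measure (Outcome q H l m k) := (M.outcomeLaw k).1

instance (k : ℕ) : IsProbabilityMeasure (M.law k) := (M.outcomeLaw k).2

/-- The joint law of the outcomes of the first `k` episodes and of the next covariates and the next
sampled parameter. -/
noncomputable def drawLaw (k : ℕ) : Measure (Outcome q H l m k × Covariate m × Param l) :=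
  M.law k ⊗ₘ M.draw (M.law k)

instance (k : ℕ) : IsProbabilityMeasure (M.drawLaw k) := by
  unfold drawLaw; infer_instance

theorem law_zero : M.law 0 = M.prior.map fun θ => (θ, Fin.elim0) := rfl

theorem law_succ (k : ℕ) :
    M.law (k + 1) = ((M.drawLaw k).prod (noiseLaw q H)).map (M.extend k) := rfl

/-- The first `k` of `K` episodes. -/
def truncate {q H l m k K : ℕ} (h : k ≤ K) (ω : Outcome q H l m K) : Outcome q H l m k :=
  (ω.1, fun i => ω.2 (i.castLE h))

@[fun_prop]
theorem measurable_truncate {k K : ℕ} (h : k ≤ K) :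
    Measurable (truncate h : Outcome q H l m K → Outcome q H l m k) := by
  unfold truncate; fun_prop

theorem map_draw_law_succ (k : ℕ) :
    (M.law (k + 1)).map (fun ω => (truncate k.le_succ ω, (ω.2 (Fin.last k)).2.1,
      (ω.2 (Fin.last k)).1)) = M.drawLaw k := by
  rw [law_succ, Measure.map_map (by fun_prop) (M.measurable_extend k)]
  have : ((fun ω : Outcome q H l m (k + 1) => (truncate k.le_succ ω, (ω.2 (Fin.last k)).2.1,
      (ω.2 (Fin.last k)).1)) ∘ M.extend k) = Prod.fst := by
    funext u
    refine Prod.ext (Prod.ext rfl (funext fun i => ?_)) (Prod.ext ?_ ?_)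
    · change (M.extend k u).2 i.castSucc = _
      simp [extend]
    · simp [extend]
    · simp [extend]
  rw [this, Measure.map_fst_prod]
  simp

theorem map_truncate_law {k K : ℕ} (h : k ≤ K) : (M.law K).map (truncate h) = M.law k := by
  induction K, h using Nat.le_induction with
  | base => exact Measure.map_id
  | succ K h ih =>
    have h1 : (M.law (K + 1)).map (truncate K.le_succ) = M.law K := by
      have h2 := congrArg (Measure.map Prod.fst) (M.map_draw_law_succ K)
      rw [Measure.map_map measurable_fst (by fun_prop)] at h2
      refine h2.trans ?_
      rw [drawLaw]
      exact Measure.fst_compProd _ _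
    rw [← ih, ← h1, Measure.map_map (measurable_truncate h) (by fun_prop)]
    rfl

/-- In every episode `k`, the covariates and the sample are drawn as prescribed by `draw`. -/
theorem map_draw_law {K : ℕ} (k : Fin K) :
    (M.law K).map (fun ω => (truncate k.isLt.le ω, (ω.2 k).2.1, (ω.2 k).1)) = M.drawLaw k := by
  rw [← M.map_draw_law_succ, ← M.map_truncate_law (Nat.succ_le_of_lt k.isLt),
    Measure.map_map (by fun_prop) (by fun_prop)]
  rfl

theorem map_observed_compProd_posterior (k : ℕ) :
    (M.law k).map observed ⊗ₘ posterior (M.law k) = (M.law k).map fun ω => (observed ω, ω.1) :=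
  compProd_map_condDistrib measurable_fst.aemeasurable

theorem lintegral_drawLaw (k : ℕ)
    {f : (Fin k → Episode q H m) × Param l × Covariate m × Param l → ℝ≥0∞} (hf : Measurable f) :
    ∫⁻ u, f (observed u.1, u.1.1, u.2.1, u.2.2) ∂M.drawLaw k
      = ∫⁻ o, ∫⁻ z, ∫⁻ θ, ∫⁻ θ', f (o, θ, z, θ') ∂posterior (M.law k) o
          ∂posterior (M.law k) o ∂M.covariateLaw k o ∂(M.law k).map observed := by
  have hobs : Measurable (observed : Outcome q H l m k → _) := measurable_observed
  rw [drawLaw, Measure.lintegral_compProd (by fun_prop)]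
  set κ := M.covariateLaw k ×ₖ posterior (M.law k) with hκ
  have hg : Measurable fun v : (Fin k → Episode q H m) × Param l =>
      ∫⁻ w, f (v.1, v.2, w.1, w.2) ∂κ v.1 := by
    have := Measurable.lintegral_kernel_prod_right
      (κ := κ.comap (Prod.fst : (Fin k → Episode q H m) × Param l → _) measurable_fst)
      (f := fun v w => f (v.1, v.2, w.1, w.2)) (hf.comp (by fun_prop))
    simpa only [Kernel.comap_apply] using this
  calc ∫⁻ ω, ∫⁻ w, f (observed ω, ω.1, w.1, w.2) ∂M.draw (M.law k) ω ∂M.law k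
      = ∫⁻ ω, (fun v : (Fin k → Episode q H m) × Param l =>
          ∫⁻ w, f (v.1, v.2, w.1, w.2) ∂κ v.1) (observed ω, ω.1) ∂M.law k := rfl
    _ = ∫⁻ v, ∫⁻ w, f (v.1, v.2, w.1, w.2) ∂κ v.1
          ∂((M.law k).map fun ω => (observed ω, ω.1)) :=
        (lintegral_map hg (by fun_prop)).symm
    _ = _ := by
        rw [← map_observed_compProd_posterior, Measure.lintegral_compProd hg]
        refine lintegral_congr fun o => ?_
        have hfo : Measurable fun v : Param l × Covariate m × Param l => f (o, v) :=
          hf.comp (by fun_prop)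
        have : ∀ θ, ∫⁻ w, f (o, θ, w.1, w.2) ∂κ o
            = ∫⁻ z, ∫⁻ θ', f (o, θ, z, θ') ∂posterior (M.law k) o ∂M.covariateLaw k o := by
          intro θ
          rw [hκ, Kernel.prod_apply, lintegral_prod]
          exact (hfo.comp (by fun_prop :
            Measurable fun w : Covariate m × Param l => (θ, w.1, w.2))).aemeasurable
        simp_rw [this]
        refine lintegral_lintegral_swap (Measurable.aemeasurable ?_)
        exact Measurable.lintegral_prod_right' (f := fun v : (Param l × Covariate m) × Param l =>
          f (o, v.1.1, v.1.2, v.2)) (by fun_prop)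

/-- Posterior sampling: given the observations and the new covariates, the true parameter and the
sampled parameter are exchangeable. -/
theorem map_drawLaw_swap (k : ℕ) :
    (M.drawLaw k).map (fun u => (observed u.1, u.2.2, u.2.1, u.1.1))
      = (M.drawLaw k).map (fun u => (observed u.1, u.1.1, u.2.1, u.2.2)) := by
  have hobs : Measurable (observed : Outcome q H l m k → _) := measurable_observed
  refine Measure.ext_of_lintegral _ fun f hf => ?_
  rw [lintegral_map hf (by fun_prop), lintegral_map hf (by fun_prop), M.lintegral_drawLaw k hf,
    M.lintegral_drawLaw k (f := fun v => f (v.1, v.2.2.2, v.2.2.1, v.2.1)) (by fun_prop)]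
  refine lintegral_congr fun o => lintegral_congr fun z => ?_
  exact lintegral_lintegral_swap (by fun_prop)

/-- The outcomes in which the true and the sampled parameters lie in the support of the prior, the
covariates lie in the set of possible covariates, and the seller follows the planning routine. -/
def IsAdmissible {k : ℕ} (ω : Outcome q H l m k) : Prop :=
  ω.1 ∈ M.prior.support ∧ ∀ i, (ω.2 i).1 ∈ M.prior.support ∧ (ω.2 i).2.1 ∈ M.covariates ∧
    (ω.2 i).2.2.1 = M.plan (ω.2 i).1 (ω.2 i).2.1

/-- Every measurable property shared by all admissible outcomes holds almost surely. The set of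
admissible outcomes itself need not be measurable, because the set of possible covariates is an
arbitrary set: it has full measure for each conditional law separately, and without measurability
this does not pass to the joint law. -/
theorem ae_law_of_isAdmissible {k : ℕ} {E : Set (Outcome q H l m k)} (hE : MeasurableSet E)
    (h : ∀ ω, M.IsAdmissible ω → ω ∈ E) : ∀ᵐ ω ∂M.law k, ω ∈ E := by
  have hsupp : MeasurableSet M.prior.support := Measure.isClosed_support.measurableSet
  induction k with
  | zero =>
    rw [law_zero, ae_map_iff (p := fun ω => ω ∈ E) (by fun_prop) hE]
    filter_upwards [M.prior.support_mem_ae] with θ hθ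
    exact h _ ⟨hθ, fun i => i.elim0⟩
  | succ k ih =>
    set N : Set ((Outcome q H l m k × Covariate m × Param l) × (Fin H → ProductVec q)) :=
      (M.extend k ⁻¹' E)ᶜ with hN
    have hNm : MeasurableSet N := (M.measurable_extend k hE).compl
    set B : Set (Outcome q H l m k × Covariate m × Param l) :=
      {u | noiseLaw q H (Prod.mk u ⁻¹' N) ≠ 0} with hB
    have hBm : MeasurableSet B :=
      (measurable_measure_prodMk_left hNm) (measurableSet_singleton 0).compl
    have hpost : ∀ᵐ ω ∂M.law k, posterior (M.law k) (observed ω) (M.prior.support)ᶜ = 0 := by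
      have h1 : ∀ᵐ ω ∂M.law k, ω ∈ {ω : Outcome q H l m k | ω.1 ∈ M.prior.support} :=
        ih (measurable_fst hsupp) fun ω hω => hω.1
      have h2 : ∀ᵐ v ∂((M.law k).map observed ⊗ₘ posterior (M.law k)),
          v.2 ∈ M.prior.support := by
        have hobs : Measurable (observed : Outcome q H l m k → _) := measurable_observed
        rw [map_observed_compProd_posterior, ae_map_iff (by fun_prop) (measurable_snd hsupp)]
        exact h1
      have h3 := Measure.ae_ae_of_ae_compProd h2
      exact ae_of_ae_map measurable_observed.aemeasurable h3
    have hdraw : ∀ᵐ ω ∂M.law k, M.draw (M.law k) ω (Prod.mk ω ⁻¹' B) = 0 := by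
      have hm : Measurable fun ω : Outcome q H l m k =>
          posterior (M.law k) (observed ω) (M.prior.support)ᶜ :=
        (Kernel.measurable_coe _ hsupp.compl).comp measurable_observed
      have hE' : MeasurableSet {ω : Outcome q H l m k |
          posterior (M.law k) (observed ω) (M.prior.support)ᶜ = 0 →
            M.draw (M.law k) ω (Prod.mk ω ⁻¹' B) = 0} := by
        refine MeasurableSet.imp (hm (measurableSet_singleton 0)) ?_
        exact Kernel.measurable_kernel_prodMk_left hBm (measurableSet_singleton 0)
      have hE'' := ih hE' fun ω hω hp => by
        have hκ : M.draw (M.law k) ω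
            = (M.covariateLaw k (observed ω)).prod (posterior (M.law k) (observed ω)) := by
          rw [draw, Kernel.comap_apply, Kernel.prod_apply]
        have hz : ∀ᵐ w ∂(M.draw (M.law k) ω), w.1 ∈ M.covariates := by
          rw [hκ]
          exact Measure.quasiMeasurePreserving_fst.ae (M.covariateLaw_mem k (observed ω))
        have hθ : ∀ᵐ w ∂(M.draw (M.law k) ω), w.2 ∈ M.prior.support := by
          rw [hκ]
          refine Measure.quasiMeasurePreserving_snd.ae (p := fun θ => θ ∈ M.prior.support) ?_
          exact hp
        have : ∀ᵐ w ∂(M.draw (M.law k) ω), w ∉ Prod.mk ω ⁻¹' B := by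
          filter_upwards [hz, hθ] with w hwz hwθ
          have hempty : Prod.mk (ω, w) ⁻¹' N = ∅ := by
            refine Set.eq_empty_of_forall_notMem fun ξ hξ => hξ (h _ ⟨hω.1, fun i => ?_⟩)
            refine Fin.lastCases ?_ (fun i => ?_) i
            · simpa [extend] using ⟨hwθ, hwz⟩
            · simpa [extend] using hω.2 i
          simp [hB, hempty]
        simp only [ae_iff, not_not] at this
        exact this
      filter_upwards [hE'', hpost] with ω h1 h2 using h1 h2
    -- `B` is measurable, in contrast to the set of inadmissible draws
    have hjoint : ∀ᵐ u ∂M.drawLaw k, u ∉ B := by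
      refine Measure.ae_compProd_of_ae_ae hBm.compl ?_
      filter_upwards [hdraw] with ω hω
      simp only [ae_iff, not_not]
      exact hω
    rw [law_succ, ae_map_iff (p := fun ω => ω ∈ E) (M.measurable_extend k).aemeasurable hE]
    change ((M.drawLaw k).prod (noiseLaw q H)) N = 0
    rw [Measure.measure_prod_null hNm]
    filter_upwards [hjoint] with u hu
    simpa [hB] using hu

/-- A multiplicative functional of the episodes has expectation at most `c ^ k` if, for each
parameter, covariates and policy, its expectation over the demand noise of one episode is at most
`c`. -/
theorem lintegral_prod_law_le (g : Param l × Episode q H m → ℝ≥0∞) (hg : Measurable g) {c : ℝ≥0∞}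
    (hc : ∀ θ z P, ∫⁻ ξ, g (θ, z, P, M.realizedDemand θ z P ξ) ∂noiseLaw q H ≤ c) (k : ℕ) :
    ∫⁻ ω, ∏ i, g (ω.1, observed ω i) ∂M.law k ≤ c ^ k := by
  have hmeas : ∀ k, Measurable fun ω : Outcome q H l m k => ∏ i, g (ω.1, observed ω i) := by
    intro k
    unfold observed
    fun_prop
  induction k with
  | zero => simp
  | succ k ih =>
    rw [law_succ, lintegral_map (hmeas _) (M.measurable_extend k),
      lintegral_prod (fun v => ∏ i, g ((M.extend k v).1, observed (M.extend k v) i))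
        ((hmeas _).comp (M.measurable_extend k)).aemeasurable]
    have hpt : ∀ (u : Outcome q H l m k × Covariate m × Param l) (ξ : Fin H → ProductVec q),
        ∏ i, g ((M.extend k (u, ξ)).1, observed (M.extend k (u, ξ)) i)
          = (∏ i, g (u.1.1, observed u.1 i)) * g (u.1.1, u.2.1, M.plan u.2.2 u.2.1,
              M.realizedDemand u.1.1 u.2.1 (M.plan u.2.2 u.2.1) ξ) := by
      intro u ξ
      rw [Fin.prod_univ_castSucc]
      simp [extend, observed]
    simp_rw [hpt]
    calc _ ≤ ∫⁻ u, (∏ i, g (u.1.1, observed u.1 i)) * c ∂M.drawLaw k := by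
          refine lintegral_mono fun u => ?_
          rw [lintegral_const_mul _ ?_]
          · gcongr
            exact hc _ _ _
          · exact hg.comp (measurable_const.prodMk (measurable_const.prodMk
              (measurable_const.prodMk (M.measurable_realizedDemand.comp (by fun_prop :
                Measurable fun ξ : Fin H → ProductVec q =>
                  (u.1.1, u.2.1, M.plan u.2.2 u.2.1, ξ))))))
      _ = (∫⁻ u, (∏ i, g (u.1.1, observed u.1 i)) ∂M.drawLaw k) * c :=
          lintegral_mul_const _ ((hmeas k).comp measurable_fst)
      _ = (∫⁻ ω, (∏ i, g (ω.1, observed ω i)) ∂M.law k) * c := by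
          congr 1
          rw [drawLaw, Measure.lintegral_compProd
            (f := fun u => ∏ i, g (u.1.1, observed u.1 i)) ((hmeas k).comp measurable_fst)]
          simp
      _ ≤ c ^ k * c := by gcongr
      _ = c ^ (k + 1) := (pow_succ c k).symm

end PricingModel

/-! ### Exponential moments of the demand noise -/

theorem lintegral_pi_prod {ι : Type*} [Fintype ι] {X : ι → Type*} [∀ i, MeasurableSpace (X i)]
    (μ : ∀ i, Measure (X i)) [∀ i, IsProbabilityMeasure (μ i)] (f : ∀ i, X i → ℝ≥0∞)
    (hf : ∀ i, Measurable (f i)) :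
    ∫⁻ x, ∏ i, f i (x i) ∂Measure.pi μ = ∏ i, ∫⁻ x, f i x ∂μ i := by
  have hind : iIndepFun (fun i (x : ∀ i, X i) => f i (x i)) (Measure.pi μ) :=
    iIndepFun_pi fun i => (hf i).aemeasurable
  have h := lintegral_prod_eq_prod_lintegral_of_indepFun Finset.univ
    (fun i (x : ∀ i, X i) => f i (x i)) hind fun i => (hf i).comp (measurable_pi_apply i)
  refine h.trans (Finset.prod_congr rfl fun i _ => ?_)
  exact (measurePreserving_eval μ i).lintegral_comp (hf i)

theorem lintegral_exp_mul_gaussianReal (t : ℝ) :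
    ∫⁻ x, ENNReal.ofReal (Real.exp (t * x)) ∂gaussianReal 0 1
      = ENNReal.ofReal (Real.exp (t ^ 2 / 2)) := by
  rw [← ofReal_integral_eq_lintegral_ofReal (integrable_exp_mul_gaussianReal t)
    (ae_of_all _ fun _ => (Real.exp_pos _).le)]
  have h := mgf_gaussianReal (p := gaussianReal 0 1) (X := id) (μ := 0) (v := 1) (by simp) t
  simp only [mgf, id] at h
  rw [h]
  norm_num

theorem lintegral_exp_abs_gaussianReal_le :
    ∫⁻ x, ENNReal.ofReal (Real.exp |x|) ∂gaussianReal 0 1 ≤ ENNReal.ofReal (Real.exp (6 / 5)) := by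
  have hpt : ∀ x : ℝ, ENNReal.ofReal (Real.exp |x|)
      ≤ ENNReal.ofReal (Real.exp (1 * x)) + ENNReal.ofReal (Real.exp (-1 * x)) := by
    intro x
    rw [one_mul, neg_one_mul]
    rcases abs_cases x with ⟨h, _⟩ | ⟨h, _⟩ <;> rw [h]
    · exact le_self_add
    · exact le_add_self
  refine (lintegral_mono hpt).trans ?_
  rw [lintegral_add_left (by fun_prop), lintegral_exp_mul_gaussianReal,
    lintegral_exp_mul_gaussianReal, ← ENNReal.ofReal_add (Real.exp_pos _).le (Real.exp_pos _).le]
  refine ENNReal.ofReal_le_ofReal ?_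
  -- `2 = exp (log 2)` and `log 2 + 1 / 2 ≤ 6 / 5`
  have h2 : Real.exp (Real.log 2) = 2 := Real.exp_log (by norm_num)
  have : Real.exp (1 ^ 2 / 2) + Real.exp ((-1) ^ 2 / 2) = Real.exp (Real.log 2 + 1 / 2) := by
    rw [Real.exp_add, h2]; norm_num; ring
  rw [this, Real.exp_le_exp]
  linarith [Real.log_two_lt_d9]

namespace PricingModel

variable {q n H l m : ℕ} (M : PricingModel q n H l m)

theorem lintegral_noiseLaw_prod (f : Fin H → Fin q → ℝ → ℝ≥0∞) (hf : ∀ h j, Measurable (f h j)) :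
    ∫⁻ ξ, ∏ h, ∏ j, f h j (ξ h j) ∂noiseLaw q H
      = ∏ h, ∏ j, ∫⁻ x, f h j x ∂gaussianReal 0 1 := by
  rw [noiseLaw, lintegral_pi_prod _ (fun h (x : ProductVec q) => ∏ j, f h j (x j))
    (fun h => by fun_prop)]
  exact Finset.prod_congr rfl fun h _ => lintegral_pi_prod _ _ (hf h)

/-! ### Log-demand residuals and likelihood ratios -/

/-- The demand that is expected under `θ` in period `h` of the episode `e` for product `j`. -/
def expectedDemand (θ : Param l) (e : Episode q H m) (h : Fin H) (j : Fin q) : ℝ :=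
  M.demand θ (e.2.1 h) (stateAt n e.2.1 h) e.1 j

/-- The residual of the logarithm of the realized demand, centred so that under the true parameter
it is `σ` times a standard normal variable. -/
noncomputable def residual (θ : Param l) (e : Episode q H m) (h : Fin H) (j : Fin q) : ℝ :=
  Real.log (e.2.2 h j) + M.σ ^ 2 / 2 - M.expectedDemand θ e h j

/-- Half of the log-likelihood ratio of `θ₀` against `θ` for one realized demand, compensated by its
conditional exponential moment under `θ`. -/
noncomputable def logRatio (θ₀ θ : Param l) (e : Episode q H m) (h : Fin H) (j : Fin q) : ℝ :=
  (M.residual θ e h j ^ 2 - M.residual θ₀ e h j ^ 2) / (4 * M.σ ^ 2)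
    + (M.expectedDemand θ₀ e h j - M.expectedDemand θ e h j) ^ 2 / (8 * M.σ ^ 2)

theorem measurable_expectedDemand (h : Fin H) (j : Fin q) :
    Measurable fun v : Param l × Episode q H m => M.expectedDemand v.1 v.2 h j := by
  have hS : Measurable fun v : Param l × Episode q H m => (stateAt n v.2.2.1 h : PriceState q n) :=
    (measurable_stateAt h).comp (by fun_prop)
  have hg : Measurable fun v : Param l × Episode q H m =>
      (v.1, v.2.2.1 h, (stateAt n v.2.2.1 h : PriceState q n), v.2.1) :=
    measurable_fst.prodMk ((by fun_prop : Measurable fun v : Param l × Episode q H m =>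
      v.2.2.1 h).prodMk (hS.prodMk (by fun_prop)))
  exact (measurable_pi_apply j).comp (M.measurable_demand.comp hg)

@[fun_prop]
theorem _root_.Measurable.expectedDemand {Ω : Type*} [MeasurableSpace Ω] {f : Ω → Param l}
    {g : Ω → Episode q H m} (hf : Measurable f) (hg : Measurable g) (h : Fin H) (j : Fin q) :
    Measurable fun x => M.expectedDemand (f x) (g x) h j :=
  (M.measurable_expectedDemand h j).comp (hf.prodMk hg)

@[fun_prop]
theorem _root_.Measurable.residual {Ω : Type*} [MeasurableSpace Ω] {f : Ω → Param l}
    {g : Ω → Episode q H m} (hf : Measurable f) (hg : Measurable g) (h : Fin H) (j : Fin q) :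
    Measurable fun x => M.residual (f x) (g x) h j := by
  unfold PricingModel.residual; fun_prop

@[fun_prop]
theorem _root_.Measurable.logRatio {Ω : Type*} [MeasurableSpace Ω] (θ₀ : Param l)
    {f : Ω → Param l} {g : Ω → Episode q H m} (hf : Measurable f) (hg : Measurable g) (h : Fin H)
    (j : Fin q) :
    Measurable fun x => M.logRatio θ₀ (f x) (g x) h j := by
  unfold PricingModel.logRatio; fun_prop

theorem residual_realizedDemand (θ : Param l) (z : Covariate m) (P : Policy q H)
    (ξ : Fin H → ProductVec q) (h : Fin H) (j : Fin q) :
    M.residual θ (z, P, M.realizedDemand θ z P ξ) h j = M.σ * ξ h j := by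
  simp only [residual, realizedDemand, expectedDemand, Real.log_exp]
  ring

theorem logRatio_realizedDemand (θ₀ θ : Param l) (z : Covariate m) (P : Policy q H)
    (ξ ξ' : Fin H → ProductVec q) (h : Fin H) (j : Fin q) :
    M.logRatio θ₀ θ (z, P, M.realizedDemand θ z P ξ) h j =
      (M.expectedDemand θ₀ (z, P, ξ') h j - M.expectedDemand θ (z, P, ξ') h j) / (2 * M.σ) * ξ h j
      - ((M.expectedDemand θ₀ (z, P, ξ') h j - M.expectedDemand θ (z, P, ξ') h j) / (2 * M.σ)) ^ 2
        / 2 := by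
  have hσ := M.σ_pos.ne'
  have h0 : M.residual θ₀ (z, P, M.realizedDemand θ z P ξ) h j = M.σ * ξ h j
      - (M.expectedDemand θ₀ (z, P, ξ') h j - M.expectedDemand θ (z, P, ξ') h j) := by
    rw [← M.residual_realizedDemand θ z P ξ h j]
    simp only [residual, expectedDemand]
    ring
  rw [logRatio, h0, residual_realizedDemand]
  simp only [expectedDemand]
  field_simp
  ring

/-- The square root of a likelihood ratio, compensated as in `logRatio`, has expectation one. -/
theorem lintegral_exp_logRatio (θ₀ θ : Param l) (z : Covariate m) (P : Policy q H) :
    ∫⁻ ξ, ENNReal.ofReal (Real.exp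
      (∑ h, ∑ j, M.logRatio θ₀ θ (z, P, M.realizedDemand θ z P ξ) h j)) ∂noiseLaw q H = 1 := by
  set a : Fin H → Fin q → ℝ := fun h j =>
    (M.expectedDemand θ₀ (z, P, 0) h j - M.expectedDemand θ (z, P, 0) h j) / (2 * M.σ) with ha
  have hpt : ∀ ξ : Fin H → ProductVec q, ENNReal.ofReal (Real.exp
      (∑ h, ∑ j, M.logRatio θ₀ θ (z, P, M.realizedDemand θ z P ξ) h j))
      = ∏ h, ∏ j, ENNReal.ofReal (Real.exp (a h j * ξ h j - a h j ^ 2 / 2)) := by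
    intro ξ
    simp only [M.logRatio_realizedDemand θ₀ θ z P ξ 0, Real.exp_sum]
    rw [ENNReal.ofReal_prod_of_nonneg fun _ _ => Finset.prod_nonneg fun _ _ => (Real.exp_pos _).le]
    refine Finset.prod_congr rfl fun h _ => ?_
    rw [ENNReal.ofReal_prod_of_nonneg fun _ _ => (Real.exp_pos _).le]
  simp_rw [hpt]
  rw [lintegral_noiseLaw_prod (fun h j x => ENNReal.ofReal (Real.exp (a h j * x - a h j ^ 2 / 2)))
    (fun h j => by fun_prop)]
  refine Finset.prod_eq_one fun h _ => Finset.prod_eq_one fun j _ => ?_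
  have : ∀ x : ℝ, ENNReal.ofReal (Real.exp (a h j * x - a h j ^ 2 / 2))
      = ENNReal.ofReal (Real.exp (a h j * x)) * ENNReal.ofReal (Real.exp (-(a h j ^ 2 / 2))) := by
    intro x
    rw [← ENNReal.ofReal_mul (Real.exp_pos _).le, ← Real.exp_add, sub_eq_add_neg]
  simp_rw [this]
  rw [lintegral_mul_const _ (by fun_prop), lintegral_exp_mul_gaussianReal,
    ← ENNReal.ofReal_mul (Real.exp_pos _).le, ← Real.exp_add]
  simp

theorem lintegral_exp_abs_residual_le (θ : Param l) (z : Covariate m) (P : Policy q H) :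
    ∫⁻ ξ, ENNReal.ofReal (Real.exp
      (∑ h, ∑ j, |M.residual θ (z, P, M.realizedDemand θ z P ξ) h j| / M.σ)) ∂noiseLaw q H
      ≤ ENNReal.ofReal (Real.exp (6 / 5 * (H * q))) := by
  have hpt : ∀ ξ : Fin H → ProductVec q, ENNReal.ofReal (Real.exp
      (∑ h, ∑ j, |M.residual θ (z, P, M.realizedDemand θ z P ξ) h j| / M.σ))
      = ∏ h, ∏ j, ENNReal.ofReal (Real.exp |ξ h j|) := by
    intro ξ
    simp only [residual_realizedDemand, abs_mul, abs_of_pos M.σ_pos,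
      mul_div_cancel_left₀ _ M.σ_pos.ne', Real.exp_sum]
    rw [ENNReal.ofReal_prod_of_nonneg fun _ _ => Finset.prod_nonneg fun _ _ => (Real.exp_pos _).le]
    refine Finset.prod_congr rfl fun h _ => ?_
    rw [ENNReal.ofReal_prod_of_nonneg fun _ _ => (Real.exp_pos _).le]
  simp_rw [hpt]
  rw [lintegral_noiseLaw_prod (fun _ _ x => ENNReal.ofReal (Real.exp |x|))
    (fun h j => by fun_prop)]
  simp only [Finset.prod_const, Finset.card_univ, Fintype.card_fin, ← pow_mul]
  refine (pow_le_pow_left' lintegral_exp_abs_gaussianReal_le _).trans ?_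
  rw [← ENNReal.ofReal_pow (Real.exp_pos _).le, ← Real.exp_nat_mul]
  refine (ENNReal.ofReal_le_ofReal (Real.exp_le_exp.2 (le_of_eq ?_)))
  push_cast
  ring

/-- The parameters and histories for which the data are misleading: some member of the finite set
`C` of parameters has a large likelihood against `θ`, or the residuals of `θ` are large. -/
def misleading (C : Finset (Param l)) (Λ s : ℝ) (k : ℕ) :
    Set (Param l × (Fin k → Episode q H m)) :=
  {v | (∃ θ₀ ∈ C, Λ < ∑ i, ∑ h, ∑ j, M.logRatio θ₀ v.1 (v.2 i) h j) ∨
    s < ∑ i, ∑ h, ∑ j, |M.residual v.1 (v.2 i) h j|}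

theorem measurableSet_misleading (C : Finset (Param l)) (Λ s : ℝ) (k : ℕ) :
    MeasurableSet (M.misleading C Λ s k) := by
  have h2 : MeasurableSet {v : Param l × (Fin k → Episode q H m) |
      s < ∑ i, ∑ h, ∑ j, |M.residual v.1 (v.2 i) h j|} :=
    measurableSet_lt (by fun_prop) (by fun_prop)
  refine MeasurableSet.union ?_ h2
  have : {v : Param l × (Fin k → Episode q H m) |
      ∃ θ₀ ∈ C, Λ < ∑ i, ∑ h, ∑ j, M.logRatio θ₀ v.1 (v.2 i) h j}
      = ⋃ θ₀ ∈ C, {v | Λ < ∑ i, ∑ h, ∑ j, M.logRatio θ₀ v.1 (v.2 i) h j} := by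
    ext; simp
  change MeasurableSet {v : Param l × (Fin k → Episode q H m) |
      ∃ θ₀ ∈ C, Λ < ∑ i, ∑ h, ∑ j, M.logRatio θ₀ v.1 (v.2 i) h j}
  rw [this]
  exact C.measurableSet_biUnion fun θ₀ _ => measurableSet_lt (by fun_prop) (by fun_prop)

/-- Chernoff's bound for an additive functional of the episodes. -/
theorem law_lt_sum_le (F : Param l → Episode q H m → ℝ)
    (hF : Measurable fun v : Param l × Episode q H m => F v.1 v.2) {c : ℝ}
    (hc : ∀ θ z P, ∫⁻ ξ, ENNReal.ofReal (Real.exp (F θ (z, P, M.realizedDemand θ z P ξ)))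
      ∂noiseLaw q H ≤ ENNReal.ofReal (Real.exp c)) (k : ℕ) (Λ : ℝ) :
    M.law k {ω | Λ < ∑ i, F ω.1 (observed ω i)} ≤ ENNReal.ofReal (Real.exp (k * c - Λ)) := by
  have hobs : Measurable (observed : Outcome q H l m k → _) := measurable_observed
  have hobsi : ∀ i, Measurable fun ω : Outcome q H l m k => observed ω i :=
    fun i => (measurable_pi_apply i).comp hobs
  have hm : Measurable fun ω : Outcome q H l m k => ∑ i, F ω.1 (observed ω i) :=
    Finset.measurable_sum _ fun i _ => hF.comp (measurable_fst.prodMk (hobsi i))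
  have h1 := M.lintegral_prod_law_le (fun v => ENNReal.ofReal (Real.exp (F v.1 v.2)))
    (hF.exp.ennreal_ofReal) hc k
  have hpt : ∀ ω : Outcome q H l m k, ∏ i, ENNReal.ofReal (Real.exp (F ω.1 (observed ω i)))
      = ENNReal.ofReal (Real.exp (∑ i, F ω.1 (observed ω i))) := by
    intro ω
    rw [Real.exp_sum, ENNReal.ofReal_prod_of_nonneg fun _ _ => (Real.exp_pos _).le]
  simp_rw [hpt] at h1
  have h2 := mul_meas_ge_le_lintegral (μ := M.law k) hm.exp.ennreal_ofReal
    (ENNReal.ofReal (Real.exp Λ))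
  have h3 : M.law k {ω | Λ < ∑ i, F ω.1 (observed ω i)} ≤ M.law k
      {ω | ENNReal.ofReal (Real.exp Λ) ≤ ENNReal.ofReal (Real.exp (∑ i, F ω.1 (observed ω i)))} :=
    measure_mono fun ω hω => ENNReal.ofReal_le_ofReal (Real.exp_le_exp.2 (le_of_lt hω))
  refine h3.trans ?_
  rw [sub_eq_neg_add, Real.exp_add, ENNReal.ofReal_mul (Real.exp_pos _).le, Real.exp_neg,
    ENNReal.ofReal_inv_of_pos (Real.exp_pos _), mul_comm, ← div_eq_mul_inv,
    ENNReal.le_div_iff_mul_le (Or.inl (by simp [Real.exp_pos])) (Or.inl ENNReal.ofReal_ne_top),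
    mul_comm]
  refine h2.trans (h1.trans (le_of_eq ?_))
  rw [← ENNReal.ofReal_pow (Real.exp_pos _).le, ← Real.exp_nat_mul]

theorem law_misleading_le (C : Finset (Param l)) (Λ s : ℝ) (k : ℕ) :
    M.law k {ω | (ω.1, observed ω) ∈ M.misleading C Λ s k}
      ≤ ENNReal.ofReal (C.card * Real.exp (-Λ)
        + Real.exp (6 / 5 * (k * H * q) - s / M.σ)) := by
  have h1 : ∀ θ₀, M.law k {ω | Λ < ∑ i, ∑ h, ∑ j, M.logRatio θ₀ ω.1 (observed ω i) h j}
      ≤ ENNReal.ofReal (Real.exp (-Λ)) := by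
    intro θ₀
    have := M.law_lt_sum_le (fun θ e => ∑ h, ∑ j, M.logRatio θ₀ θ e h j) (by fun_prop) (c := 0)
      (fun θ z P => by rw [M.lintegral_exp_logRatio]; simp) k Λ
    simpa using this
  have h2 : M.law k {ω | s < ∑ i, ∑ h, ∑ j, |M.residual ω.1 (observed ω i) h j|}
      ≤ ENNReal.ofReal (Real.exp (6 / 5 * (k * H * q) - s / M.σ)) := by
    have := M.law_lt_sum_le (fun θ e => ∑ h, ∑ j, |M.residual θ e h j| / M.σ) (by fun_prop)
      (fun θ z P => M.lintegral_exp_abs_residual_le θ z P) k (s / M.σ)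
    simp only [← Finset.sum_div, div_lt_div_iff_of_pos_right M.σ_pos] at this
    refine this.trans (le_of_eq ?_)
    congr 3
    ring
  calc M.law k {ω | (ω.1, observed ω) ∈ M.misleading C Λ s k}
      ≤ M.law k ((⋃ θ₀ ∈ C, {ω | Λ < ∑ i, ∑ h, ∑ j, M.logRatio θ₀ ω.1 (observed ω i) h j})
          ∪ {ω | s < ∑ i, ∑ h, ∑ j, |M.residual ω.1 (observed ω i) h j|}) := by
        refine measure_mono fun ω hω => ?_
        rcases hω with ⟨θ₀, hC, h⟩ | h
        · exact Or.inl (Set.mem_biUnion (x := θ₀) hC h)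
        · exact Or.inr h
    _ ≤ ∑ _θ₀ ∈ C, ENNReal.ofReal (Real.exp (-Λ))
          + ENNReal.ofReal (Real.exp (6 / 5 * (k * H * q) - s / M.σ)) :=
        (measure_union_le _ _).trans (add_le_add ((measure_biUnion_finset_le _ _).trans
          (Finset.sum_le_sum fun θ₀ _ => h1 θ₀)) h2)
    _ = _ := by
        rw [ENNReal.ofReal_add (by positivity) (Real.exp_pos _).le,
          ENNReal.ofReal_mul (by positivity), ENNReal.ofReal_natCast]
        simp

/-! ### Admissible episodes -/

theorem stateAt_mem_stateBox {P : Policy q H} {p : ℝ} (hP : P ∈ policyBox q H p) (h : Fin H) :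
    (stateAt n P h : PriceState q n) ∈ stateBox q n p := fun _ => hP _

theorem mem_domain {z : Covariate m} {P : Policy q H} (hz : z ∈ M.covariates)
    (hP : P ∈ policyBox q H M.pMax) (h : Fin H) : (P h, stateAt n P h, z) ∈ M.domain :=
  ⟨hP h, stateAt_mem_stateBox hP h, hz⟩

theorem expectedDemand_mem {θ : Param l} (hθ : θ ∈ M.prior.support) {e : Episode q H m}
    (hz : e.1 ∈ M.covariates) (hP : e.2.1 ∈ policyBox q H M.pMax) (h : Fin H) (j : Fin q) :
    M.expectedDemand θ e h j ∈ Set.Icc 0 M.dMax :=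
  M.demand_mem θ hθ _ (hP h) _ (stateAt_mem_stateBox hP h) _ hz j

theorem value_eq_sum (θ : Param l) (e : Episode q H m) :
    M.value θ e.1 e.2.1 = ∑ h, ∑ j, e.2.1 h j * M.expectedDemand θ e h j := rfl

theorem value_mem {θ : Param l} (hθ : θ ∈ M.prior.support) {z : Covariate m} {P : Policy q H}
    (hz : z ∈ M.covariates) (hP : P ∈ policyBox q H M.pMax) :
    M.value θ z P ∈ Set.Icc 0 (q * M.pMax * (H * M.dMax)) := by
  have hD := fun h j => M.expectedDemand_mem hθ (e := (z, P, 0)) hz hP h j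
  rw [M.value_eq_sum θ (z, P, 0)]
  constructor
  · exact Finset.sum_nonneg fun h _ => Finset.sum_nonneg fun j _ =>
      mul_nonneg (hP h j).1 (hD h j).1
  · calc ∑ h, ∑ j, P h j * M.expectedDemand θ (z, P, 0) h j
        ≤ ∑ _h : Fin H, ∑ _j : Fin q, M.pMax * M.dMax := by
          refine Finset.sum_le_sum fun h _ => Finset.sum_le_sum fun j _ => ?_
          exact mul_le_mul (hP h j).2 (hD h j).2 (hD h j).1 M.pMax_pos.le
      _ = q * M.pMax * (H * M.dMax) := by
          simp; ring

/-- The values of one policy under two parameters differ by at most `√q p_max` times the sum of the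
Euclidean distances of the expected demands. -/
theorem value_sub_value_le (θ θ' : Param l) {e : Episode q H m}
    (hP : e.2.1 ∈ policyBox q H M.pMax) :
    M.value θ' e.1 e.2.1 - M.value θ e.1 e.2.1 ≤ √(q : ℝ) * M.pMax *
      ∑ h, √(∑ j, (M.expectedDemand θ' e h j - M.expectedDemand θ e h j) ^ 2) := by
  rw [value_eq_sum, value_eq_sum, ← Finset.sum_sub_distrib, Finset.mul_sum]
  refine Finset.sum_le_sum fun h _ => ?_
  rw [← Finset.sum_sub_distrib]
  calc ∑ j, (e.2.1 h j * M.expectedDemand θ' e h j - e.2.1 h j * M.expectedDemand θ e h j)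
      ≤ ∑ j, M.pMax * |M.expectedDemand θ' e h j - M.expectedDemand θ e h j| := by
        refine Finset.sum_le_sum fun j _ => ?_
        rw [← mul_sub]
        refine (le_abs_self _).trans ?_
        rw [abs_mul, abs_of_nonneg (hP h j).1]
        exact mul_le_mul_of_nonneg_right (hP h j).2 (abs_nonneg _)
    _ = M.pMax * ∑ j, |M.expectedDemand θ' e h j - M.expectedDemand θ e h j| := by
        rw [Finset.mul_sum]
    _ ≤ M.pMax * (√(q : ℝ) *
          √(∑ j, (M.expectedDemand θ' e h j - M.expectedDemand θ e h j) ^ 2)) := by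
        refine mul_le_mul_of_nonneg_left ?_ M.pMax_pos.le
        rw [← Real.sqrt_mul (Nat.cast_nonneg _)]
        refine Real.le_sqrt_of_sq_le ?_
        have := sq_sum_le_card_mul_sum_sq (s := (Finset.univ : Finset (Fin q)))
          (f := fun j => |M.expectedDemand θ' e h j - M.expectedDemand θ e h j|)
        simpa using this
    _ = _ := by ring

theorem nonempty_support : M.prior.support.Nonempty :=
  Measure.nonempty_support M.prior_prob.ne_zero

theorem demandClass_nonempty : M.demandClass.Nonempty := M.nonempty_support.image _

theorem one_le_of_coveringNumber_eq {α : ℝ} {N : ℕ} (hN : M.coveringNumber α = N) : 1 ≤ N := by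
  have h : 0 < M.coveringNumber α :=
    Metric.coveringNumber_pos_iff.2 (M.demandClass_nonempty.image _)
  rw [hN] at h
  exact_mod_cast h

theorem exists_finset_cover {α : ℝ} (hα : 0 ≤ α) {N : ℕ} (hN : M.coveringNumber α = N) :
    ∃ C : Finset (Param l), C.card ≤ N ∧ (∀ θ₀ ∈ C, θ₀ ∈ M.prior.support) ∧
      ∀ θ ∈ M.prior.support, ∃ θ₀ ∈ C, ∀ (e : Episode q H m), e.1 ∈ M.covariates →
        e.2.1 ∈ policyBox q H M.pMax → ∀ h j,
          |M.expectedDemand θ e h j - M.expectedDemand θ₀ e h j| ≤ α := by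
  classical
  have hne : Metric.coveringNumber α.toNNReal (UniformFun.ofFun '' M.demandClass) ≠ ⊤ := by
    change M.coveringNumber α ≠ ⊤
    rw [hN]; exact ENat.natCast_ne_top N
  obtain ⟨D, hDsub, hDfin, hDcov, hDcard⟩ := Metric.exists_set_encard_eq_coveringNumber hne
  have hcard : hDfin.toFinset.card = N := by
    have : D.encard = N := hDcard.trans hN
    rw [hDfin.encard_eq_coe_toFinset_card] at this
    exact_mod_cast this
  have hpre : ∀ g ∈ D, ∃ θ ∈ M.prior.support, UniformFun.ofFun
      (fun (u : M.domain) => M.demand θ u.1.1 u.1.2.1 u.1.2.2) = g := by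
    intro g hg
    obtain ⟨_, ⟨θ, hθ, rfl⟩, rfl⟩ := hDsub hg
    exact ⟨θ, hθ, rfl⟩
  choose! c hc hceq using hpre
  refine ⟨hDfin.toFinset.image c, Finset.card_image_le.trans hcard.le, ?_, fun θ hθ => ?_⟩
  · intro θ₀ h
    obtain ⟨g, hg, rfl⟩ := Finset.mem_image.1 h
    exact hc g (hDfin.mem_toFinset.1 hg)
  · obtain ⟨g, hg, hdist⟩ := hDcov ⟨_, ⟨θ, hθ, rfl⟩, rfl⟩
    refine ⟨c g, Finset.mem_image_of_mem _ (hDfin.mem_toFinset.2 hg), fun e hz hP h j => ?_⟩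
    rw [← hceq g hg] at hdist
    have h1 := UniformFun.edist_le.1 hdist ⟨_, M.mem_domain hz hP h⟩
    have h2 := (edist_pi_le_iff.1 h1) j
    rw [edist_dist] at h2
    have h3 : dist (M.expectedDemand θ e h j) (M.expectedDemand (c g) e h j) ≤ α :=
      (ENNReal.ofReal_le_ofReal_iff hα).1 h2
    simpa [Real.dist_eq] using h3

/-! ### The confidence set -/

theorem mul_le_sqrt_mul_log_four {σ : ℝ} (hσ : 0 < σ) :
    16 / 5 * σ ≤ √(8 * σ ^ 2 * Real.log 4) := by
  refine Real.le_sqrt_of_sq_le ?_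
  have : Real.log 4 = 2 * Real.log 2 := by
    rw [show (4 : ℝ) = 2 ^ 2 by norm_num, Real.log_pow]; norm_num
  rw [this]
  nlinarith [Real.log_two_gt_d9, sq_pos_of_pos hσ]

/-- If the data are not misleading for `θ` and `θ'` fits them at least as well, then the demands
expected under `θ` and `θ'` are close along the history. The least-squares estimate yields
`16 σ² log (T² N) + O(q / T)`. The resulting slack against `4 q β` absorbs the terms that come from
the discretization. -/
theorem sum_sq_expectedDemand_sub_le {k N : ℕ} (hq : 1 ≤ q) {T : ℝ} (hT : 1 ≤ T)
    (hk : (k * H : ℝ) ≤ T) (hN : 1 ≤ N) {C : Finset (Param l)}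
    (hC : ∀ θ₀ ∈ C, θ₀ ∈ M.prior.support)
    (hcov : ∀ θ ∈ M.prior.support, ∃ θ₀ ∈ C, ∀ (e : Episode q H m), e.1 ∈ M.covariates →
        e.2.1 ∈ policyBox q H M.pMax → ∀ h j,
          |M.expectedDemand θ e h j - M.expectedDemand θ₀ e h j| ≤ T ^ (-2 : ℤ))
    (o : Fin k → Episode q H m)
    (ho : ∀ i, (o i).1 ∈ M.covariates ∧ (o i).2.1 ∈ policyBox q H M.pMax)
    {θ θ' : Param l} (hθ : θ ∈ M.prior.support) (hθ' : θ' ∈ M.prior.support)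
    (hmis : (θ, o) ∉ M.misleading C (Real.log (T ^ 2 * N)) (16 / 5 * (q * T) * M.σ) k)
    (hfit : ∑ i, ∑ h, ∑ j, M.residual θ' (o i) h j ^ 2
      ≤ ∑ i, ∑ h, ∑ j, M.residual θ (o i) h j ^ 2) :
    ∑ i, ∑ h, ∑ j, (M.expectedDemand θ' (o i) h j - M.expectedDemand θ (o i) h j) ^ 2
      ≤ 4 * (q * M.beta T N) := by
  obtain ⟨θ₀, hθ₀C, hclose⟩ := hcov θ' hθ'
  have hθ₀ := hC θ₀ hθ₀C
  simp only [misleading, Set.mem_ofPred_eq, not_or, not_exists, not_and, not_lt] at hmis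
  have hT0 : 0 < T := by linarith
  have hmain := sum_sq_sub_le_of_sum_sq_residual_le
    (Finset.univ : Finset (Fin k × Fin H × Fin q))
    (fun t => Real.log ((o t.1).2.2 t.2.1 t.2.2) + M.σ ^ 2 / 2)
    (fun t => M.expectedDemand θ (o t.1) t.2.1 t.2.2)
    (fun t => M.expectedDemand θ' (o t.1) t.2.1 t.2.2)
    (fun t => M.expectedDemand θ₀ (o t.1) t.2.1 t.2.2)
    (α := T ^ (-2 : ℤ)) (D := M.dMax) (Λ := Real.log (T ^ 2 * N))
    (s := 16 / 5 * (q * T) * M.σ) M.σ_pos (by positivity)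
    (fun t _ => M.expectedDemand_mem hθ (ho t.1).1 (ho t.1).2 _ _)
    (fun t _ => M.expectedDemand_mem hθ' (ho t.1).1 (ho t.1).2 _ _)
    (fun t _ => M.expectedDemand_mem hθ₀ (ho t.1).1 (ho t.1).2 _ _)
    (fun t _ => hclose _ (ho t.1).1 (ho t.1).2 _ _)
    (by simp only [Fintype.sum_prod_type]; exact hfit)
    (by simp only [Fintype.sum_prod_type]; exact hmis.1 θ₀ hθ₀C)
    (by simp only [Fintype.sum_prod_type]; exact hmis.2)
  simp only [Fintype.sum_prod_type] at hmain
  refine hmain.trans ?_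
  have hΛ : 0 ≤ Real.log (T ^ 2 * N) := by
    refine Real.log_nonneg ?_
    have : (1 : ℝ) ≤ N := by exact_mod_cast hN
    nlinarith
  have hq' : (1 : ℝ) ≤ q := by exact_mod_cast hq
  have hσ := mul_le_sqrt_mul_log_four M.σ_pos
  have hcard : ((Finset.univ : Finset (Fin k × Fin H × Fin q)).card : ℝ) ≤ T * q := by
    simp only [Finset.card_univ, Fintype.card_prod, Fintype.card_fin]
    push_cast
    nlinarith
  have hd := M.dMax_pos
  have e1 : 10 * T ^ (-2 : ℤ) * M.dMax
      * ((Finset.univ : Finset (Fin k × Fin H × Fin q)).card : ℝ) ≤ 10 * M.dMax * q / T := by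
    calc _ ≤ 10 * T ^ (-2 : ℤ) * M.dMax * (T * q) := by gcongr
      _ = 10 * M.dMax * q / T := by
        rw [zpow_neg]; field_simp
  have e2 : 8 * T ^ (-2 : ℤ) * (16 / 5 * (q * T) * M.σ) = 8 * q * (16 / 5 * M.σ) / T := by
    rw [zpow_neg]; field_simp
  have e3 : 8 * q * (16 / 5 * M.σ) / T ≤ 8 * q * √(8 * M.σ ^ 2 * Real.log 4) / T := by gcongr
  have e4 : 10 * M.dMax * q / T ≤ 64 * M.dMax * q / T := by gcongr; norm_num
  have e5 : 16 * M.σ ^ 2 * Real.log (T ^ 2 * N) ≤ 32 * M.σ ^ 2 * Real.log (T ^ 2 * N) * q := by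
    have : 0 ≤ M.σ ^ 2 * Real.log (T ^ 2 * N) := by positivity
    nlinarith
  rw [e2, beta]
  calc _ ≤ 32 * M.σ ^ 2 * Real.log (T ^ 2 * N) * q
        + 8 * q * √(8 * M.σ ^ 2 * Real.log 4) / T + 64 * M.dMax * q / T := by linarith
    _ = _ := by ring

/-- The pathwise bound: the differences between the values that the sampled and the true parameters
assign to the applied policies add up to the bound of the theorem, apart from the episodes in which
the data were misleading for one of the two parameters. -/
theorem sum_value_sub_value_le {K N dE : ℕ} (hq : 1 ≤ q) (hH : 1 ≤ H) (hK : 1 ≤ K)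
    (hdE : M.eluderDim (((K : ℝ) * H) ^ (-2 : ℤ)) = dE) (hN : 1 ≤ N) {C : Finset (Param l)}
    (hC : ∀ θ₀ ∈ C, θ₀ ∈ M.prior.support)
    (hcov : ∀ θ ∈ M.prior.support, ∃ θ₀ ∈ C, ∀ (e : Episode q H m), e.1 ∈ M.covariates →
        e.2.1 ∈ policyBox q H M.pMax → ∀ h j,
          |M.expectedDemand θ e h j - M.expectedDemand θ₀ e h j| ≤ ((K : ℝ) * H) ^ (-2 : ℤ))
    {ω : Outcome q H l m K} (hω : M.IsAdmissible ω) (bad : Fin K → Prop) [DecidablePred bad]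
    (hbad : ∀ k : Fin K, ¬ bad k → ∀ θ ∈ ({ω.1, (ω.2 k).1} : Set (Param l)),
      (θ, observed (truncate k.isLt.le ω)) ∉ M.misleading C (Real.log (((K : ℝ) * H) ^ 2 * N))
        (16 / 5 * (q * ((K : ℝ) * H)) * M.σ) k) :
    ∑ k, (M.value (ω.2 k).1 (ω.2 k).2.1 (ω.2 k).2.2.1 - M.value ω.1 (ω.2 k).2.1 (ω.2 k).2.2.1)
      ≤ q * M.pMax * (1 + H * M.dMax * dE
            + 4 * Real.sqrt (M.beta ((K : ℝ) * H) N * dE * ((K : ℝ) * H)))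
        + ∑ k, if bad k then q * M.pMax * (H * M.dMax) else 0 := by
  set T : ℝ := (K : ℝ) * H with hTdef
  have hH' : (1 : ℝ) ≤ H := by exact_mod_cast hH
  have hK' : (1 : ℝ) ≤ K := by exact_mod_cast hK
  have hT : 1 ≤ T := by nlinarith
  have hT0 : 0 < T := by linarith
  have hq' : (1 : ℝ) ≤ q := by exact_mod_cast hq
  have hp := M.pMax_pos
  have hd := M.dMax_pos
  have hz : ∀ k, (ω.2 k).2.1 ∈ M.covariates := fun k => (hω.2 k).2.1
  have hP : ∀ k, (ω.2 k).2.2.1 ∈ policyBox q H M.pMax := fun k => by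
    rw [(hω.2 k).2.2]; exact M.plan_mem _ (hω.2 k).1 _ (hz k)
  set D : Param l → Fin K → Fin H → Fin q → ℝ :=
    fun θ k h j => M.expectedDemand θ (ω.2 k).2 h j with hD
  have hDmem : ∀ θ ∈ M.prior.support, ∀ k h j, D θ k h j ∈ Set.Icc 0 M.dMax :=
    fun θ hθ k h j => M.expectedDemand_mem hθ (hz k) (hP k) h j
  have hβ : 0 ≤ M.beta T N := by
    have : (1 : ℝ) ≤ N := by exact_mod_cast hN
    have : 0 ≤ Real.log (T ^ 2 * N) := Real.log_nonneg (by nlinarith)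
    unfold beta
    positivity
  set Γ : ℝ := 4 * (q * M.beta T N) with hΓ
  have hΓ0 : 0 ≤ Γ := by positivity
  -- the confidence set, for the episodes that are not bad
  have hconf : ∀ k : Fin K, ¬ bad k →
      ∑ i : Fin k, ∑ h, ∑ j,
        (D (ω.2 k).1 (i.castLE k.isLt.le) h j - D ω.1 (i.castLE k.isLt.le) h j) ^ 2 ≤ Γ := by
    intro k hk
    have hkT : ((k : ℕ) * H : ℝ) ≤ T := by
      have : ((k : ℕ) : ℝ) ≤ K := by exact_mod_cast k.isLt.le
      rw [hTdef]; gcongr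
    have ho : ∀ i, (observed (truncate k.isLt.le ω) i).1 ∈ M.covariates ∧
        (observed (truncate k.isLt.le ω) i).2.1 ∈ policyBox q H M.pMax := fun i => ⟨hz _, hP _⟩
    rcases le_total
      (∑ i, ∑ h, ∑ j, M.residual (ω.2 k).1 (observed (truncate k.isLt.le ω) i) h j ^ 2)
      (∑ i, ∑ h, ∑ j, M.residual ω.1 (observed (truncate k.isLt.le ω) i) h j ^ 2) with hfit | hfit
    · exact M.sum_sq_expectedDemand_sub_le hq hT hkT hN hC hcov _ ho hω.1 (hω.2 k).1
        (hbad k hk _ (by simp)) hfit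
    · have := M.sum_sq_expectedDemand_sub_le hq hT hkT hN hC hcov _ ho (hω.2 k).1 hω.1
        (hbad k hk _ (by simp)) hfit
      refine le_of_eq_of_le ?_ this
      refine Finset.sum_congr rfl fun i _ => Finset.sum_congr rfl fun h _ =>
        Finset.sum_congr rfl fun j _ => ?_
      rw [← neg_sub, neg_sq]
      rfl
  -- the deviations at the prices that are set, with the bad episodes discarded
  set dev : Fin K → Fin H → ℝ := fun k h => √(∑ j, (D (ω.2 k).1 k h j - D ω.1 k h j) ^ 2) with hdev
  set w : Fin K ×ₗ Fin H → ℝ := fun t =>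
    if bad (ofLex t).1 then 0 else dev (ofLex t).1 (ofLex t).2 with hw
  have hdev_le : ∀ k h, dev k h ≤ √(q : ℝ) * M.dMax := by
    intro k h
    refine Real.sqrt_le_iff.2 ⟨by positivity, ?_⟩
    rw [mul_pow, Real.sq_sqrt (Nat.cast_nonneg q)]
    calc ∑ j, (D (ω.2 k).1 k h j - D ω.1 k h j) ^ 2 ≤ ∑ _j : Fin q, M.dMax ^ 2 := by
          refine Finset.sum_le_sum fun j _ => sq_le_sq' ?_ ?_
          all_goals
            linarith [(hDmem _ (hω.2 k).1 k h j).1, (hDmem _ (hω.2 k).1 k h j).2,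
              (hDmem _ hω.1 k h j).1, (hDmem _ hω.1 k h j).2]
      _ = q * M.dMax ^ 2 := by simp
  set emb : Param l → M.domain → EuclideanSpace ℝ (Fin q) := fun θ u =>
    WithLp.toLp 2 (M.demand θ u.1.1 u.1.2.1 u.1.2.2) with hemb
  set x : Fin K ×ₗ Fin H → M.domain := fun t =>
    ⟨_, M.mem_domain (hz (ofLex t).1) (hP (ofLex t).1) (ofLex t).2⟩ with hx
  have hnorm : ∀ θ θ' t, ‖emb θ (x t) - emb θ' (x t)‖ ^ 2
      = ∑ j, (D θ (ofLex t).1 (ofLex t).2 j - D θ' (ofLex t).1 (ofLex t).2 j) ^ 2 := by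
    intro θ θ' t
    rw [EuclideanSpace.norm_sq_eq]
    simp only [Real.norm_eq_abs, sq_abs]
    rfl
  have hcount : ∀ ε, T ^ (-2 : ℤ) ≤ ε →
      (((Finset.univ : Finset (Fin K ×ₗ Fin H)).filter fun t => ε < w t).card : ℝ)
        ≤ Γ * dE / ε ^ 2 + (H * dE : ℕ) := by
    intro ε hε
    have hε0 : 0 < ε := lt_of_lt_of_le (by positivity) hε
    have hgood : ∀ t ∈ (Finset.univ : Finset (Fin K ×ₗ Fin H)).filter (fun t => ε < w t),
        ¬ bad (ofLex t).1 ∧ ε < dev (ofLex t).1 (ofLex t).2 := by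
      intro t ht
      have h1 := (Finset.mem_filter.1 ht).2
      by_cases hb : bad (ofLex t).1
      · simp only [hw, if_pos hb] at h1
        exact absurd h1 (not_lt.2 hε0.le)
      · simp only [hw, if_neg hb] at h1
        exact ⟨hb, h1⟩
    have hmem : ∀ θ ∈ M.prior.support, emb θ ∈ ((fun g u => WithLp.toLp 2 (g u)) '' M.demandClass :
        Set (M.domain → EuclideanSpace ℝ (Fin q))) :=
      fun θ hθ => ⟨_, ⟨θ, hθ, rfl⟩, rfl⟩
    have h := card_le_of_large_deviation _ hε hε0 hΓ0 hH hdE x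
      (fun t => ((ofLex t).1 : ℕ)) (fun s t hst => Prod.Lex.monotone_fst _ _ hst)
      ((Finset.univ : Finset (Fin K ×ₗ Fin H)).filter (fun t => ε < w t)) ?_
      (fun t => emb (ω.2 (ofLex t).1).1) (fun _ => emb ω.1) (fun t _ => hmem _ (hω.2 _).1)
      (fun _ _ => hmem _ hω.1) ?_ ?_
    · refine h.trans (le_of_eq ?_)
      push_cast
      ring
    · intro k
      refine (Finset.card_le_card_of_injOn (t := (Finset.univ : Finset (Fin H)))
        (fun s => (ofLex s).2) (fun _ _ => Finset.mem_coe.2 (Finset.mem_univ _)) ?_).trans (by simp)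
      intro s hs s' hs' hss
      have h1 := (Finset.mem_filter.1 (Finset.mem_coe.1 hs)).2
      have h2 := (Finset.mem_filter.1 (Finset.mem_coe.1 hs')).2
      exact ofLex.injective (Prod.ext (Fin.ext (h1.trans h2.symm)) hss)
    · intro t ht
      refine (hgood t ht).2.trans_le (le_of_eq ?_)
      rw [hdev]
      beta_reduce
      rw [← hnorm, Real.sqrt_sq (norm_nonneg _)]
    · intro t ht
      refine le_trans ?_ (hconf _ (hgood t ht).1)
      simp only [hnorm]
      set k := (ofLex t).1 with hk
      let f : Fin k × Fin H → Fin K ×ₗ Fin H := fun v => toLex (v.1.castLE k.isLt.le, v.2)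
      have hf : Function.Injective f := by
        rintro ⟨a, b⟩ ⟨a', b'⟩ hab
        have h1 := congrArg (fun s => (ofLex s).1) hab
        have h2 := congrArg (fun s => (ofLex s).2) hab
        simp only [f, ofLex_toLex] at h1 h2
        exact Prod.ext (Fin.castLE_injective _ h1) h2
      calc _ ≤ ∑ s ∈ Finset.univ.image f, ∑ j, (D (ω.2 k).1 (ofLex s).1 (ofLex s).2 j
              - D ω.1 (ofLex s).1 (ofLex s).2 j) ^ 2 := by
            refine Finset.sum_le_sum_of_subset_of_nonneg (fun s hs => ?_)
              fun _ _ _ => Finset.sum_nonneg fun _ _ => sq_nonneg _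
            have h1 := (Finset.mem_filter.1 hs).2
            exact Finset.mem_image.2 ⟨(⟨_, h1⟩, (ofLex s).2), Finset.mem_univ _, rfl⟩
        _ = _ := by
            rw [Finset.sum_image hf.injOn, Fintype.sum_prod_type]
            rfl
  have hsum := sum_le_of_card_filter_le (Finset.univ : Finset (Fin K ×ₗ Fin H)) w
    (α := T ^ (-2 : ℤ)) (A := Γ * dE) (C := √(q : ℝ) * M.dMax) (B := H * dE) (by positivity)
    (by positivity) (by positivity) (fun t _ => by
      simp only [hw]
      split_ifs
      · positivity
      · exact hdev_le _ _) hcount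
  have hcardT : ((Finset.univ : Finset (Fin K ×ₗ Fin H)).card : ℝ) = T := by
    have : (Finset.univ : Finset (Fin K ×ₗ Fin H)).card = K * H := by
      rw [Finset.card_univ, Fintype.card_lex, Fintype.card_prod, Fintype.card_fin, Fintype.card_fin]
    rw [this]; push_cast; rfl
  rw [hcardT] at hsum
  have hsumw : ∑ t, w t = ∑ k, ∑ h, if bad k then 0 else dev k h := by
    rw [← Fintype.sum_prod_type']
    exact Fintype.sum_equiv ofLex _ _ fun t => rfl
  have hTα : T * T ^ (-2 : ℤ) ≤ √(q : ℝ) := by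
    have h1 : T * T ^ (-2 : ℤ) = 1 / T := by rw [zpow_neg]; field_simp
    have h2 : 1 / T ≤ 1 := by rw [div_le_one hT0]; exact hT
    have h3 : 1 ≤ √(q : ℝ) := Real.one_le_sqrt.2 hq'
    linarith
  have hroot : 2 * √(Γ * dE * T) = √(q : ℝ) * (4 * √(M.beta T N * dE * T)) := by
    have : Γ * dE * T = (2 : ℝ) ^ 2 * (q * (M.beta T N * dE * T)) := by rw [hΓ]; ring
    rw [this, Real.sqrt_mul (by norm_num), Real.sqrt_sq (by norm_num),
      Real.sqrt_mul (Nat.cast_nonneg q)]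
    ring
  have hstep : ∀ k, M.value (ω.2 k).1 (ω.2 k).2.1 (ω.2 k).2.2.1
      - M.value ω.1 (ω.2 k).2.1 (ω.2 k).2.2.1
      ≤ √(q : ℝ) * M.pMax * (∑ h, if bad k then 0 else dev k h)
        + if bad k then q * M.pMax * (H * M.dMax) else 0 := by
    intro k
    by_cases hb : bad k
    · simp only [if_pos hb, Finset.sum_const_zero, mul_zero, zero_add]
      linarith [(M.value_mem (hω.2 k).1 (hz k) (hP k)).2, (M.value_mem hω.1 (hz k) (hP k)).1]
    · simp only [if_neg hb, add_zero]
      exact M.value_sub_value_le ω.1 (ω.2 k).1 (e := (ω.2 k).2) (hP k)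
  calc _ ≤ ∑ k, (√(q : ℝ) * M.pMax * (∑ h, if bad k then 0 else dev k h)
        + if bad k then q * M.pMax * (H * M.dMax) else 0) := Finset.sum_le_sum fun k _ => hstep k
    _ = √(q : ℝ) * M.pMax * (∑ t, w t) + ∑ k, if bad k then q * M.pMax * (H * M.dMax) else 0 := by
        rw [Finset.sum_add_distrib, hsumw, Finset.mul_sum]
    _ ≤ √(q : ℝ) * M.pMax * (√(q : ℝ) * (1 + H * M.dMax * dE + 4 * √(M.beta T N * dE * T)))
        + ∑ k, if bad k then q * M.pMax * (H * M.dMax) else 0 := by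
        gcongr
        rw [hroot] at hsum
        push_cast at hsum
        refine hsum.trans ?_
        linarith
    _ = _ := by
        have : √(q : ℝ) * √(q : ℝ) = q := Real.mul_self_sqrt (Nat.cast_nonneg q)
        rw [show ∀ a b : ℝ, √(q : ℝ) * a * (√(q : ℝ) * b) = (√(q : ℝ) * √(q : ℝ)) * a * b by
          intros; ring, this]

/-! ### The Bayesian regret -/

@[fun_prop]
theorem _root_.Measurable.value {Ω : Type*} [MeasurableSpace Ω] {f : Ω → Param l}
    {g : Ω → Covariate m} {P : Ω → Policy q H} (hf : Measurable f) (hg : Measurable g)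
    (hP : Measurable P) : Measurable fun x => M.value (f x) (g x) (P x) := by
  have : (fun x => M.value (f x) (g x) (P x))
      = fun x => ∑ h, ∑ j, P x h j * M.expectedDemand (f x) (g x, P x, 0) h j := by
    funext x
    exact M.value_eq_sum (f x) (g x, P x, 0)
  rw [this]
  fun_prop

@[fun_prop]
theorem _root_.Measurable.plan {Ω : Type*} [MeasurableSpace Ω] {f : Ω → Param l}
    {g : Ω → Covariate m} (hf : Measurable f) (hg : Measurable g) :
    Measurable fun x => M.plan (f x) (g x) :=
  M.measurable_plan.comp (hf.prodMk hg)

@[fun_prop]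
theorem _root_.Measurable.observed {Ω : Type*} [MeasurableSpace Ω] {k : ℕ}
    {f : Ω → Outcome q H l m k} (hf : Measurable f) : Measurable fun x => observed (f x) :=
  measurable_observed.comp hf

theorem map_law_swap {K : ℕ} (k : Fin K) :
    (M.law K).map (fun ω => (observed (truncate k.isLt.le ω), (ω.2 k).1, (ω.2 k).2.1, ω.1))
      = (M.law K).map
        (fun ω => (observed (truncate k.isLt.le ω), ω.1, (ω.2 k).2.1, (ω.2 k).1)) := by
  have h := M.map_drawLaw_swap (k : ℕ)
  rw [← M.map_draw_law k, Measure.map_map (by fun_prop) (by fun_prop),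
    Measure.map_map (by fun_prop) (by fun_prop)] at h
  exact h

theorem integrable_of_isAdmissible {K : ℕ} {W : Outcome q H l m K → ℝ} (hW : Measurable W) (B : ℝ)
    (h : ∀ ω, M.IsAdmissible ω → |W ω| ≤ B) : Integrable W (M.law K) := by
  refine Integrable.of_bound hW.aestronglyMeasurable B ?_
  exact M.ae_law_of_isAdmissible (E := {ω | ‖W ω‖ ≤ B})
    (measurableSet_le (by fun_prop) (by fun_prop)) h

/-- Thompson sampling: the optimal value has the same expectation under the true and under the
sampled parameter. -/
theorem integral_value_plan_eq {K : ℕ} (k : Fin K) :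
    ∫ ω, M.value ω.1 (ω.2 k).2.1 (M.plan ω.1 (ω.2 k).2.1) ∂M.law K
      = ∫ ω, M.value (ω.2 k).1 (ω.2 k).2.1 (M.plan (ω.2 k).1 (ω.2 k).2.1) ∂M.law K := by
  have hf : Measurable fun v : (Fin k → Episode q H m) × Param l × Covariate m × Param l =>
      M.value v.2.1 v.2.2.1 (M.plan v.2.1 v.2.2.1) := by fun_prop
  have h1 := integral_map (μ := M.law K) (φ := fun ω =>
    (observed (truncate k.isLt.le ω), (ω.2 k).1, (ω.2 k).2.1, ω.1)) (by fun_prop)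
    hf.aestronglyMeasurable
  have h2 := integral_map (μ := M.law K) (φ := fun ω =>
    (observed (truncate k.isLt.le ω), ω.1, (ω.2 k).2.1, (ω.2 k).1)) (by fun_prop)
    hf.aestronglyMeasurable
  rw [M.map_law_swap k] at h1
  exact h2.symm.trans h1

/-- In each episode, the data are misleading for the true or for the sampled parameter with
probability at most `4 / (K H)²`. By exchangeability it suffices to consider the true parameter. -/
theorem law_real_misleading_le {K N : ℕ} (k : Fin K) (hq : 1 ≤ q) (hH : 1 ≤ H) (hN : 1 ≤ N)
    {C : Finset (Param l)} (hC : C.card ≤ N) :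
    (M.law K).real {ω | ∃ θ ∈ ({ω.1, (ω.2 k).1} : Set (Param l)),
      (θ, observed (truncate k.isLt.le ω)) ∈ M.misleading C (Real.log (((K : ℝ) * H) ^ 2 * N))
        (16 / 5 * (q * ((K : ℝ) * H)) * M.σ) k} ≤ 4 / ((K : ℝ) * H) ^ 2 := by
  set T : ℝ := (K : ℝ) * H with hT
  set A := M.misleading C (Real.log (T ^ 2 * N)) (16 / 5 * (q * T) * M.σ) k with hA
  have hAm : MeasurableSet A := M.measurableSet_misleading _ _ _ _
  have hK' : (1 : ℝ) ≤ K := by exact_mod_cast (Nat.succ_le_of_lt (k.pos))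
  have hH' : (1 : ℝ) ≤ H := by exact_mod_cast hH
  have hq' : (1 : ℝ) ≤ q := by exact_mod_cast hq
  have hN' : (1 : ℝ) ≤ N := by exact_mod_cast hN
  have hT1 : 1 ≤ T := by nlinarith
  have h1 : (M.law K) {ω | (ω.1, observed (truncate k.isLt.le ω)) ∈ A}
      = (M.law k) {ω | (ω.1, observed ω) ∈ A} := by
    rw [← M.map_truncate_law k.isLt.le, Measure.map_apply (by fun_prop)]
    · rfl
    · exact (by fun_prop : Measurable fun ω : Outcome q H l m k => (ω.1, observed ω)) hAm
  have h2 : (M.law K) {ω | ((ω.2 k).1, observed (truncate k.isLt.le ω)) ∈ A}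
      = (M.law K) {ω | (ω.1, observed (truncate k.isLt.le ω)) ∈ A} := by
    have hB : MeasurableSet {v : (Fin k → Episode q H m) × Param l × Covariate m × Param l |
        (v.2.1, v.1) ∈ A} :=
      (by fun_prop : Measurable fun v : (Fin k → Episode q H m) × Param l × Covariate m × Param l =>
        (v.2.1, v.1)) hAm
    have h := congrArg (fun μ => μ {v : (Fin k → Episode q H m) × Param l × Covariate m × Param l |
        (v.2.1, v.1) ∈ A}) (M.map_law_swap k)
    beta_reduce at h
    rwa [Measure.map_apply (by fun_prop) hB, Measure.map_apply (by fun_prop) hB] at h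
  have h3 : (M.law k) {ω | (ω.1, observed ω) ∈ A} ≤ ENNReal.ofReal (2 / T ^ 2) := by
    refine (M.law_misleading_le C _ _ k).trans (ENNReal.ofReal_le_ofReal ?_)
    have e1 : (C.card : ℝ) * Real.exp (-Real.log (T ^ 2 * N)) ≤ 1 / T ^ 2 := by
      rw [Real.exp_neg, Real.exp_log (by positivity)]
      have : (C.card : ℝ) ≤ N := by exact_mod_cast hC
      calc (C.card : ℝ) * (T ^ 2 * N)⁻¹ ≤ N * (T ^ 2 * N)⁻¹ := by gcongr
        _ = 1 / T ^ 2 := by field_simp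
    have e2 : Real.exp (6 / 5 * (k * H * q) - 16 / 5 * (q * T) * M.σ / M.σ) ≤ 1 / T ^ 2 := by
      have hk : ((k : ℕ) : ℝ) * H * q ≤ T * q := by
        have : ((k : ℕ) : ℝ) ≤ K := by exact_mod_cast k.isLt.le
        rw [hT]; gcongr
      -- `k H ≤ T` and `6 / 5 - 16 / 5 = -2`
      have hle : 6 / 5 * (((k : ℕ) : ℝ) * H * q) - 16 / 5 * (q * T) * M.σ / M.σ ≤ -T + -T := by
        rw [mul_div_cancel_right₀ _ M.σ_pos.ne']
        nlinarith
      have hTe : T ≤ Real.exp T := by linarith [Real.add_one_le_exp T]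
      calc _ ≤ Real.exp (-T + -T) := Real.exp_le_exp.2 hle
        _ = 1 / Real.exp T ^ 2 := by rw [Real.exp_add, Real.exp_neg]; field_simp
        _ ≤ 1 / T ^ 2 := by gcongr
    calc _ ≤ 1 / T ^ 2 + 1 / T ^ 2 := add_le_add e1 e2
      _ = 2 / T ^ 2 := by ring
  rw [measureReal_def]
  refine ENNReal.toReal_le_of_le_ofReal (by positivity) ?_
  calc (M.law K) {ω | ∃ θ ∈ ({ω.1, (ω.2 k).1} : Set (Param l)),
        (θ, observed (truncate k.isLt.le ω)) ∈ A}
      ≤ (M.law K) {ω | (ω.1, observed (truncate k.isLt.le ω)) ∈ A}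
        + (M.law K) {ω | ((ω.2 k).1, observed (truncate k.isLt.le ω)) ∈ A} := by
        refine (measure_mono fun ω hω => ?_).trans (measure_union_le _ _)
        obtain ⟨θ, rfl | rfl, h⟩ := hω
        · exact Or.inl h
        · exact Or.inr h
    _ ≤ ENNReal.ofReal (2 / T ^ 2) + ENNReal.ofReal (2 / T ^ 2) := by
        rw [h2, h1]; exact add_le_add h3 h3
    _ = ENNReal.ofReal (4 / T ^ 2) := by
        rw [← ENNReal.ofReal_add (by positivity) (by positivity)]
        congr 1; ring

theorem regret_eq_zero_of_isEmpty (M : PricingModel 0 n H l m) (K : ℕ) : M.regret K = 0 := by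
  have : ∀ θ z P, M.value θ z P = 0 := fun θ z P => by simp [value, revenue]
  simp [regret, this]

/-- The trivial bound on the regret. -/
theorem regret_le_mul (K : ℕ) : M.regret K ≤ q * M.pMax * M.dMax * (K * H) := by
  have hpt : ∀ ω : Outcome q H l m K, M.IsAdmissible ω →
      |∑ k, (M.value ω.1 (ω.2 k).2.1 (M.plan ω.1 (ω.2 k).2.1)
        - M.value ω.1 (ω.2 k).2.1 (ω.2 k).2.2.1)| ≤ q * M.pMax * M.dMax * (K * H) := by
    intro ω hω
    refine (Finset.abs_sum_le_sum_abs _ _).trans ?_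
    have hk : ∀ k ∈ (Finset.univ : Finset (Fin K)),
        |M.value ω.1 (ω.2 k).2.1 (M.plan ω.1 (ω.2 k).2.1)
          - M.value ω.1 (ω.2 k).2.1 (ω.2 k).2.2.1| ≤ q * M.pMax * (H * M.dMax) := by
      intro k _
      obtain ⟨h1, h2, h3⟩ := hω.2 k
      have hP : (ω.2 k).2.2.1 ∈ policyBox q H M.pMax := by rw [h3]; exact M.plan_mem _ h1 _ h2
      have v1 := M.value_mem hω.1 h2 (M.plan_mem _ hω.1 _ h2)
      have v2 := M.value_mem hω.1 h2 hP
      rw [abs_le]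
      constructor <;> linarith [v1.1, v1.2, v2.1, v2.2]
    refine (Finset.sum_le_card_nsmul _ _ _ hk).trans (le_of_eq ?_)
    simp; ring
  have hm : Measurable fun ω : Outcome q H l m K =>
      ∑ k, (M.value ω.1 (ω.2 k).2.1 (M.plan ω.1 (ω.2 k).2.1)
        - M.value ω.1 (ω.2 k).2.1 (ω.2 k).2.2.1) := by fun_prop
  have := integral_mono_ae (M.integrable_of_isAdmissible hm _ hpt)
    (integrable_const (μ := M.law K) ((q : ℝ) * M.pMax * M.dMax * (K * H)))
    (M.ae_law_of_isAdmissible (measurableSet_le hm measurable_const)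
      fun ω hω => (le_abs_self _).trans (hpt ω hω))
  exact this.trans (by simp)

/-- The finite-time regret bound. -/
theorem regret_le {K dE N : ℕ} (hH : 1 ≤ H) (hK : 1 ≤ K)
    (hdE : M.eluderDim (((K : ℝ) * H) ^ (-2 : ℤ)) = dE)
    (hN : M.coveringNumber (((K : ℝ) * H) ^ (-2 : ℤ)) = N) :
    M.regret K ≤ q * M.pMax * (1 + H * M.dMax * dE
        + 4 * Real.sqrt (M.beta ((K : ℝ) * H) N * dE * ((K : ℝ) * H)))
      + 4 * q * M.pMax * M.dMax / ((K : ℝ) * H) := by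
  classical
  rcases Nat.eq_zero_or_pos q with rfl | hq
  · rw [regret_eq_zero_of_isEmpty]; simp
  have hN1 := M.one_le_of_coveringNumber_eq hN
  obtain ⟨C, hCcard, hC, hcov⟩ := M.exists_finset_cover (by positivity) hN
  set R : ℝ := q * M.pMax * (1 + H * M.dMax * dE
        + 4 * Real.sqrt (M.beta ((K : ℝ) * H) N * dE * ((K : ℝ) * H))) with hR
  set V : ℝ := q * M.pMax * (H * M.dMax) with hV
  set bad : Fin K → Set (Outcome q H l m K) := fun k =>
    {ω | ∃ θ ∈ ({ω.1, (ω.2 k).1} : Set (Param l)),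
      (θ, observed (truncate k.isLt.le ω)) ∈ M.misleading C (Real.log (((K : ℝ) * H) ^ 2 * N))
        (16 / 5 * (q * ((K : ℝ) * H)) * M.σ) k} with hbad
  have hbadm : ∀ k, MeasurableSet (bad k) := by
    intro k
    have hA := M.measurableSet_misleading C (Real.log (((K : ℝ) * H) ^ 2 * N))
        (16 / 5 * (q * ((K : ℝ) * H)) * M.σ) k
    have h1 := (by fun_prop : Measurable fun ω : Outcome q H l m K =>
      (ω.1, observed (truncate k.isLt.le ω))) hA
    have h2 := (by fun_prop : Measurable fun ω : Outcome q H l m K =>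
      ((ω.2 k).1, observed (truncate k.isLt.le ω))) hA
    convert h1.union h2 using 1
    ext ω
    simp [hbad]
  set opt : Fin K → Outcome q H l m K → ℝ := fun k ω =>
    M.value ω.1 (ω.2 k).2.1 (M.plan ω.1 (ω.2 k).2.1) with hopt
  set smp : Fin K → Outcome q H l m K → ℝ := fun k ω =>
    M.value (ω.2 k).1 (ω.2 k).2.1 (M.plan (ω.2 k).1 (ω.2 k).2.1) with hsmp
  set act : Fin K → Outcome q H l m K → ℝ := fun k ω =>
    M.value ω.1 (ω.2 k).2.1 (ω.2 k).2.2.1 with hact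
  have hPbox : ∀ ω : Outcome q H l m K, M.IsAdmissible ω → ∀ k,
      (ω.2 k).2.2.1 ∈ policyBox q H M.pMax := fun ω hω k => by
    rw [(hω.2 k).2.2]; exact M.plan_mem _ (hω.2 k).1 _ (hω.2 k).2.1
  have habs : ∀ {x : ℝ}, x ∈ Set.Icc 0 V → |x| ≤ V := fun h => by
    rw [abs_of_nonneg h.1]; exact h.2
  have hopti : ∀ k, Integrable (opt k) (M.law K) := fun k =>
    M.integrable_of_isAdmissible (by fun_prop) V fun ω hω => habs
      (M.value_mem hω.1 (hω.2 k).2.1 (M.plan_mem _ hω.1 _ (hω.2 k).2.1))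
  have hsmpi : ∀ k, Integrable (smp k) (M.law K) := fun k =>
    M.integrable_of_isAdmissible (by fun_prop) V fun ω hω => habs
      (M.value_mem (hω.2 k).1 (hω.2 k).2.1 (M.plan_mem _ (hω.2 k).1 _ (hω.2 k).2.1))
  have hacti : ∀ k, Integrable (act k) (M.law K) := fun k =>
    M.integrable_of_isAdmissible (by fun_prop) V fun ω hω => habs
      (M.value_mem hω.1 (hω.2 k).2.1 (hPbox ω hω k))
  -- exchangeability replaces the optimal value by its counterpart for the sampled parameter
  have hreg : M.regret K = ∫ ω, ∑ k, (smp k ω - act k ω) ∂M.law K := by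
    change ∫ ω, ∑ k, (opt k ω - act k ω) ∂M.law K = _
    rw [integral_finsetSum (f := fun k ω => opt k ω - act k ω) _
        fun k _ => (hopti k).sub (hacti k),
      integral_finsetSum (f := fun k ω => smp k ω - act k ω) _
        fun k _ => (hsmpi k).sub (hacti k)]
    refine Finset.sum_congr rfl fun k _ => ?_
    rw [integral_sub (hopti k) (hacti k), integral_sub (hsmpi k) (hacti k),
      M.integral_value_plan_eq k]
  have hbadi : ∀ k, Integrable ((bad k).indicator fun _ => V) (M.law K) := fun k =>
    (integrable_const V).indicator (hbadm k)
  have hpath : ∀ᵐ ω ∂M.law K, ∑ k, (smp k ω - act k ω)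
      ≤ R + ∑ k, (bad k).indicator (fun _ => V) ω := by
    have hm : Measurable fun ω => ∑ k, (smp k ω - act k ω) := by fun_prop
    refine M.ae_law_of_isAdmissible (measurableSet_le hm ?_) fun ω hω => ?_
    · exact measurable_const.add (Finset.measurable_sum _ fun k _ =>
        measurable_const.indicator (hbadm k))
    · have h := M.sum_value_sub_value_le hq hH hK hdE hN1 hC hcov hω (fun k => ω ∈ bad k)
        (fun k hk θ hθ hmem => hk ⟨θ, hθ, hmem⟩)
      refine le_trans (le_of_eq ?_) (h.trans (le_of_eq ?_))
      · refine Finset.sum_congr rfl fun k _ => ?_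
        rw [hsmp, hact]
        beta_reduce
        rw [(hω.2 k).2.2]
      · simp only [Set.indicator_apply]; rfl
  have hT0 : (0 : ℝ) < (K : ℝ) * H := by
    have : 0 < K * H := Nat.mul_pos hK hH
    exact_mod_cast this
  have hp := M.pMax_pos
  have hd := M.dMax_pos
  calc M.regret K ≤ ∫ ω, (R + ∑ k, (bad k).indicator (fun _ => V) ω) ∂M.law K := by
        rw [hreg]
        exact integral_mono_ae (integrable_finsetSum _ fun k _ => (hsmpi k).sub (hacti k))
          ((integrable_const R).add (integrable_finsetSum _ fun k _ => hbadi k)) hpath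
    _ = R + ∑ k, (M.law K).real (bad k) * V := by
        rw [integral_add (integrable_const R) (integrable_finsetSum _ fun k _ => hbadi k),
          integral_finsetSum _ fun k _ => hbadi k]
        simp only [integral_indicator_const _ (hbadm _), smul_eq_mul]
        simp
    _ ≤ R + ∑ _k : Fin K, 4 / ((K : ℝ) * H) ^ 2 * V := by
        gcongr with k
        exact M.law_real_misleading_le k hq hH hN1 hCcard
    _ = R + 4 * q * M.pMax * M.dMax / ((K : ℝ) * H) := by
        rw [Finset.sum_const, Finset.card_univ, Fintype.card_fin, nsmul_eq_mul, hV]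
        congr 1
        field_simp

/-! ### Asymptotics -/

theorem eventually_log_coveringNumber_le {dK : ℝ} (hdK : M.kolmogorovDim = dK) (h0 : 0 < dK) :
    ∀ᶠ α in 𝓝[>] (0 : ℝ), ∃ N : ℕ, M.coveringNumber α = N ∧
      Real.log N ≤ 2 * dK * Real.log (1 / α) := by
  have hlt : M.kolmogorovDim < ((2 * dK : ℝ) : EReal) := by
    rw [hdK]; exact EReal.coe_lt_coe_iff.2 (by linarith)
  have hev := eventually_lt_of_limsup_lt hlt
  have h1 : ∀ᶠ α in 𝓝[>] (0 : ℝ), α ∈ Set.Ioo (0 : ℝ) 1 := Ioo_mem_nhdsGT one_pos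
  filter_upwards [hev, h1] with α hα hα1
  have hL : 0 < Real.log (1 / α) := Real.log_pos (by rw [lt_div_iff₀ hα1.1]; linarith [hα1.2])
  change ENNReal.log (M.coveringNumber α : ℝ≥0∞) / _ < _ at hα
  rcases eq_or_ne (M.coveringNumber α) ⊤ with htop | hne
  · rw [htop] at hα
    rw [ENat.toENNReal_top, ENNReal.log_top, EReal.top_div_of_pos_ne_top
      (EReal.coe_pos.2 hL) (EReal.coe_ne_top _)] at hα
    exact absurd hα not_top_lt
  · obtain ⟨N, hN⟩ := ENat.ne_top_iff_exists.1 hne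
    have hN1 := M.one_le_of_coveringNumber_eq hN.symm
    refine ⟨N, hN.symm, ?_⟩
    have hNpos : (0 : ℝ) < N := by exact_mod_cast hN1
    rw [← hN, ENat.toENNReal_coe, ← ENNReal.ofReal_natCast, ENNReal.log_ofReal_of_pos hNpos,
      ← EReal.coe_div, EReal.coe_lt_coe_iff, div_lt_iff₀ hL] at hα
    exact hα.le

/-- A class of positive Kolmogorov dimension has two members, so that its eluder dimension is
positive at small scales. -/
theorem eventually_eluderDim_ne_zero {dK : ℝ} (hdK : M.kolmogorovDim = dK) (h0 : 0 < dK) :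
    ∀ᶠ ε in 𝓝[>] (0 : ℝ), M.eluderDim ε ≠ 0 := by
  have hnsub : ¬ M.demandClass.Subsingleton := by
    intro hsub
    obtain ⟨g, hg⟩ := M.demandClass_nonempty
    have hG : M.demandClass = {g} := hsub.eq_singleton_of_mem hg
    have : M.kolmogorovDim = 0 := by
      unfold kolmogorovDim kolmogorovDimension supCoveringNumber
      simp [hG]
    rw [hdK] at this
    exact h0.ne' (by exact_mod_cast this)
  rw [Set.not_subsingleton_iff] at hnsub
  obtain ⟨g₁, hg₁, g₂, hg₂, hne⟩ := hnsub
  obtain ⟨x, hx⟩ := Function.ne_iff.1 hne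
  have hδ : 0 < ‖(WithLp.toLp 2 (g₁ x) : EuclideanSpace ℝ (Fin q)) - WithLp.toLp 2 (g₂ x)‖ := by
    rw [norm_pos_iff, sub_ne_zero]
    exact fun h => hx ((WithLp.toLp_injective 2) h)
  filter_upwards [Ioo_mem_nhdsGT hδ] with ε hε
  have h1 : (1 : ℕ∞) ≤ M.eluderDim ε := by
    refine le_sSup ⟨1, by simp, ε, le_rfl, fun _ => x, fun i hdep => ?_⟩
    have hi : (i : ℕ) = 0 := by omega
    have := hdep _ ⟨g₁, hg₁, rfl⟩ _ ⟨g₂, hg₂, rfl⟩ (by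
      rw [Finset.sum_eq_zero fun j _ => absurd j.isLt (by omega)]
      simpa using hε.1.le)
    exact absurd this (not_le.2 hε.2)
  exact (lt_of_lt_of_le one_pos h1).ne'

/-- The asymptotic regret bound. If the eluder dimension exceeds `K H`, the trivial bound on the
regret is already of the claimed order. -/
theorem eventually_regret_le {κ dK : ℝ} (hκ : 0 < κ) (hH : 1 ≤ H) (hdK : M.kolmogorovDim = dK)
    (hκdK : κ ≤ dK) :
    ∀ᶠ K : ℕ in atTop, ∀ dE : ℕ, M.eluderDim (((K : ℝ) * H) ^ (-2 : ℤ)) = dE →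
      M.regret K ≤ (1 + 4 * √(16 / κ + 33)) * (q * M.pMax * M.σ *
        √(dK * dE * ((K : ℝ) * H) * Real.log ((K : ℝ) * H))) := by
  have hdK0 : 0 < dK := hκ.trans_le hκdK
  have hH' : (1 : ℝ) ≤ H := by exact_mod_cast hH
  have hp := M.pMax_pos
  have hd := M.dMax_pos
  have hσ := M.σ_pos
  have hT : Tendsto (fun K : ℕ => (K : ℝ) * H) atTop atTop :=
    tendsto_natCast_atTop_atTop.atTop_mul_const (by linarith)
  have hα : Tendsto (fun K : ℕ => ((K : ℝ) * H) ^ (-2 : ℤ)) atTop (𝓝[>] 0) := by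
    refine tendsto_nhdsWithin_iff.2 ⟨(tendsto_zpow_atTop_zero (by norm_num)).comp hT, ?_⟩
    filter_upwards [hT.eventually_gt_atTop 0] with K hK
    exact zpow_pos hK _
  have hlog : Tendsto (fun K : ℕ => Real.log ((K : ℝ) * H)) atTop atTop :=
    Real.tendsto_log_atTop.comp hT
  have hroot : Tendsto (fun K : ℕ => M.σ * √(dK * Real.log ((K : ℝ) * H))) atTop atTop :=
    (Real.tendsto_sqrt_atTop.comp (hlog.const_mul_atTop hdK0)).const_mul_atTop hσ
  have hlin : Tendsto (fun K : ℕ => M.σ ^ 2 * dK * Real.log ((K : ℝ) * H)) atTop atTop :=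
    hlog.const_mul_atTop (by positivity)
  filter_upwards [hα.eventually (M.eventually_log_coveringNumber_le hdK hdK0),
    hα.eventually (M.eventually_eluderDim_ne_zero hdK hdK0), hT.eventually_ge_atTop 1,
    hlog.eventually_ge_atTop 0, eventually_ge_atTop 1,
    hroot.eventually_ge_atTop (1 + H * M.dMax + 4 * M.dMax),
    hlin.eventually_ge_atTop (2 * (8 * M.dMax + √(8 * M.σ ^ 2 * Real.log 4)))]
    with K hcov hel hT1 hL0 hK hbig hdisc dE hdE
  set T : ℝ := (K : ℝ) * H with hTdef
  set L := Real.log T with hLdef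
  obtain ⟨N, hN, hlogN⟩ := hcov
  have hN1 := M.one_le_of_coveringNumber_eq hN
  have hNpos : (0 : ℝ) < N := by exact_mod_cast hN1
  have hT0 : 0 < T := by linarith
  have hdE1 : (1 : ℝ) ≤ dE := by
    have : dE ≠ 0 := by rintro rfl; exact hel (by simpa using hdE)
    exact_mod_cast Nat.one_le_iff_ne_zero.2 this
  have hX1 : 1 ≤ √(dE * T) := Real.one_le_sqrt.2 (by nlinarith)
  have hmain : √(dK * dE * T * L) = √(dK * L) * √(dE * T) := by
    rw [← Real.sqrt_mul (by positivity)]; congr 1; ring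
  rw [hmain]
  have hc0 : 0 ≤ 4 * √(16 / κ + 33) := by positivity
  rcases le_or_gt (dE : ℝ) T with hle | hgt
  · have hreg := M.regret_le hH hK hdE hN
    have hX2 : (dE : ℝ) ≤ √(dE * T) := Real.le_sqrt_of_sq_le (by nlinarith)
    have hlog' : Real.log (T ^ 2 * N) ≤ 2 * L + 4 * dK * L := by
      rw [Real.log_mul (by positivity) (by positivity), Real.log_pow]
      have : Real.log (1 / T ^ (-2 : ℤ)) = 2 * L := by
        rw [zpow_neg, one_div, inv_inv, Real.log_zpow]; norm_num [hLdef]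
      rw [this] at hlogN
      push_cast
      linarith
    have hLκ : L ≤ dK * L / κ := by
      rw [le_div_iff₀ hκ]; nlinarith
    have hβ : M.beta T N ≤ M.σ ^ 2 * (16 / κ + 33) * (dK * L) := by
      have e1 : 2 / T * (8 * M.dMax + √(8 * M.σ ^ 2 * Real.log 4)) ≤ M.σ ^ 2 * dK * L := by
        refine le_trans ?_ hdisc
        rw [div_mul_eq_mul_div]
        exact div_le_self (by positivity) hT1
      have e2 : 8 * M.σ ^ 2 * Real.log (T ^ 2 * N)
          ≤ 8 * M.σ ^ 2 * (2 * (dK * L / κ) + 4 * dK * L) := by gcongr; linarith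
      unfold beta
      calc _ ≤ 8 * M.σ ^ 2 * (2 * (dK * L / κ) + 4 * dK * L) + M.σ ^ 2 * dK * L := add_le_add e2 e1
        _ = _ := by ring
    have hsq : √(M.beta T N * dE * T) ≤ M.σ * √(16 / κ + 33) * (√(dK * L) * √(dE * T)) := by
      calc √(M.beta T N * dE * T) ≤ √(M.σ ^ 2 * ((16 / κ + 33) * ((dK * L) * (dE * T)))) := by
            refine Real.sqrt_le_sqrt ?_
            calc M.beta T N * dE * T ≤ M.σ ^ 2 * (16 / κ + 33) * (dK * L) * dE * T := by gcongr
              _ = _ := by ring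
        _ = _ := by
            rw [Real.sqrt_mul (by positivity), Real.sqrt_sq hσ.le, Real.sqrt_mul (by positivity),
              Real.sqrt_mul (by positivity)]
            ring
    have hlast : 4 * q * M.pMax * M.dMax / T ≤ q * M.pMax * (4 * M.dMax * √(dE * T)) := by
      calc 4 * q * M.pMax * M.dMax / T ≤ 4 * q * M.pMax * M.dMax :=
            div_le_self (by positivity) hT1
        _ ≤ 4 * q * M.pMax * M.dMax * √(dE * T) := le_mul_of_one_le_right (by positivity) hX1
        _ = _ := by ring
    calc M.regret K ≤ _ := hreg
      _ ≤ q * M.pMax * (√(dE * T) + H * M.dMax * √(dE * T)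
            + 4 * (M.σ * √(16 / κ + 33) * (√(dK * L) * √(dE * T))))
          + q * M.pMax * (4 * M.dMax * √(dE * T)) := by
          refine add_le_add ?_ hlast
          gcongr
      _ = q * M.pMax * ((1 + H * M.dMax + 4 * M.dMax) * √(dE * T)
            + 4 * (M.σ * √(16 / κ + 33) * (√(dK * L) * √(dE * T)))) := by ring
      _ ≤ q * M.pMax * (M.σ * √(dK * L) * √(dE * T)
            + 4 * (M.σ * √(16 / κ + 33) * (√(dK * L) * √(dE * T)))) := by gcongr
      _ = _ := by ring
  · have hX2 : T ≤ √(dE * T) := Real.le_sqrt_of_sq_le (by nlinarith)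
    have hdM : M.dMax ≤ M.σ * √(dK * L) := by nlinarith
    calc M.regret K ≤ q * M.pMax * M.dMax * T := M.regret_le_mul K
      _ ≤ q * M.pMax * (M.σ * √(dK * L)) * √(dE * T) := by gcongr
      _ = 1 * (q * M.pMax * M.σ * (√(dK * L) * √(dE * T))) := by ring
      _ ≤ _ := by gcongr; linarith

end PricingModel

theorem theorem6 :
    (∀ (q n H l m : ℕ) (M : PricingModel q n H l m) (K : ℕ), 1 ≤ H → 1 ≤ K →
      ∀ dE N : ℕ,
        M.eluderDim (((K : ℝ) * H) ^ (-2 : ℤ)) = dE →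
        M.coveringNumber (((K : ℝ) * H) ^ (-2 : ℤ)) = N →
        M.regret K ≤
          q * M.pMax * (1 + H * M.dMax * dE
            + 4 * Real.sqrt (M.beta ((K : ℝ) * H) N * dE * ((K : ℝ) * H)))
          + 4 * q * M.pMax * M.dMax / ((K : ℝ) * H)) ∧
    (∀ κ : ℝ, 0 < κ → ∃ C : ℝ, 0 < C ∧
      ∀ (q n H l m : ℕ) (M : PricingModel q n H l m) (dK : ℝ), 1 ≤ H →
        M.kolmogorovDim = dK → κ ≤ dK →
        ∀ᶠ K : ℕ in atTop, ∀ dE : ℕ,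
          M.eluderDim (((K : ℝ) * H) ^ (-2 : ℤ)) = dE →
          M.regret K ≤ C * (q * M.pMax * M.σ *
            Real.sqrt (dK * dE * ((K : ℝ) * H) * Real.log ((K : ℝ) * H)))) := by
  refine ⟨fun q n H l m M K hH hK dE N hdE hN => M.regret_le hH hK hdE hN, fun κ hκ =>
    ⟨1 + 4 * √(16 / κ + 33), by positivity, fun q n H l m M dK hH hdK hκdK => ?_⟩⟩
  exact M.eventually_regret_le hκ hH hdK hκdK
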